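/- **Model.** A network is a finite simple graph whose nodes carry distinct natural-number identifiers. In a (deterministic) LOCAL algorithm each node initially knows the number of nodes, the maximum degree of the graph, its own identifier, its own degree and its own advice string; in each synchronous round it exchanges messages of unbounded size with its neighbors and performs arbitrary local computation. For a family $\mathcal G$ of networks and a graph problem $\Pi$, a $(\mathcal G,\Pi,\beta,T)$-*advice schema* is a function that assigns to every node $v$ of every $G\in\mathcal G$ a bit-string $\ell_G(v)$ of length at most $\beta$, such that some LOCAL algorithm that is given these strings solves $\Pi$ on all $G\in\mathcal G$ in at most $T$ rounds. Nodes with a non-empty string are *bit-holding*. The schema is *1-bit uniform* if every node gets exactly one bit, and it is then *$\varepsilon$-sparse* if in each $G \in\mathcal G$ at most an $\varepsilon$ fraction of the nodes gets the bit $1$. There is a $(\mathcal G,\Pi,\gamma_0,A,T)$-*composable schema* if for all real $c>0$ and all integers $\gamma\ge\gamma_0$ and $\alpha\ge A(c,\gamma)$ there are $\beta\le c\alpha/\gamma^3$ and a $(\mathcal G,\Pi,\beta,T(\alpha))$-advice schema such that for each $G\in\mathcal G$ every ball of radius $\alpha$ in $G$ contains at most $\gamma_0$ bit-holding nodes. **Theorem.**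 For $\Delta\ge 0$ let $\mathcal E_\Delta$ be the family of bipartite networks of maximum degree at most $\Delta$ in which all degrees are even. The *splitting* problem asks for a red/blue coloring of the edges such that each node has as many red as blue incident edges. 1. There are constants $\gamma_0, C$ and a function $A$ (all independent of $\Delta$) with $A(c,\gamma)=\Theta(\gamma^3)$ for each fixed $c>0$ (the hidden constants may depend on $c$) such that for every $\Delta$ there is an $(\mathcal E_\Delta,\text{splitting},\gamma_0,A,T)$-composable schema with $T(\alpha)=\Delta^{C\alpha}$. 2. For every $\varepsilon>0$ there is a constant $C$ such that for every $\Delta$ there is an $\varepsilon$-sparse 1-bit uniform $(\mathcal E_\Delta,\text{splitting},1,\Delta^{C})$-advice schema. Now let $\Delta$ range over the powers of $2$ (including $1$), let $\mathcal R_\Delta$ be the family of bipartite $\Delta$-regular networks, and consider the problem of computing a proper edge coloring with $\Delta$ colors. 3. There are a constant $C$ and functions $\gamma_0(\Delta)=O(\Delta)$ and $A_\Delta(c,\gamma)=\Theta((\Delta\gamma)^3\log\Delta)$ (with hidden constants that do not depend on $\Delta$ and $\gamma$, but in the case of $A$ may depend on $c$) such that for every $\Delta$ there is an $(\mathcal R_\Delta,\Delta\text{-edge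 coloring},\gamma_0(\Delta),A_\Delta,T)$-composable schema with $T(\alpha)=\Delta^{C\alpha}$. 4. For every $\varepsilon>0$ there is a computable function $f$ such that for every $\Delta$ there is an $\varepsilon$-sparse 1-bit uniform $(\mathcal R_\Delta,\Delta\text{-edge coloring},1,f(\Delta))$-advice schema. -/

import Mathlib

/-- An instance of the LOCAL model: a finite simple graph whose nodes carry distinct natural-number
identifiers. -/
structure Network where
  V : Type
  [fintypeV : Fintype V]
  graph : SimpleGraph V
  ident : V → ℕ
  ident_injective : Function.Injective ident

namespace Network

instance (G : Network) : Fintype G.V := G.fintypeV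

noncomputable instance (G : Network) : DecidableRel G.graph.Adj := Classical.decRel _

end Network

/-- An assignment of a bit-string of advice to each node of each network. -/
abbrev AdviceMap : Type 1 := (G : Network) → G.V → List Bool

/-- A deterministic synchronous message-passing algorithm (LOCAL model). Messages and local
computation are unrestricted. `Out` is the type of the output of a single node. -/
structure LocalAlgorithm (Out : Type) where
  /-- internal states of a node -/
  State : Type
  /-- messages -/
  Msg : Type
  /-- the initial state, computed from: the number of nodes of the graph, the maximum degree of the
  graph, the node's own identifier, the node's own degree, and the node's advice string -/
  init : (n maxDeg ident deg : ℕ) → (advice : List Bool) → State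
  /-- the message sent to the neighbor with a given identifier (a node that has not learnt the
  identifiers of its neighbors yet can only use a rule that makes sense for all identifiers) -/
  send : State → ℕ → Msg
  /-- the new state, computed from the old one and the messages that have been received in this
  round, each of them tagged with the identifier of its sender -/
  recv : State → Set (ℕ × Msg) → State
  /-- the output of a node in a given state -/
  output : State → Out

namespace LocalAlgorithm

variable {Out : Type}

/-- The state of each node of `G` after a given number of communication rounds. -/
noncomputable def stateAfter (𝒜 : LocalAlgorithm Out) (G : Network) (advice : G.V → List Bool) :
    ℕ → G.V → 𝒜.State
  | 0 => fun v =>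
      𝒜.init (Fintype.card G.V) G.graph.maxDegree (G.ident v) (G.graph.degree v) (advice v)
  | t + 1 => fun v =>
      𝒜.recv (stateAfter 𝒜 G advice t v)
        {m | ∃ u, G.graph.Adj v u ∧
          m = (G.ident u, 𝒜.send (stateAfter 𝒜 G advice t u) (G.ident v))}

/-- The outputs of the nodes of `G` after `t` rounds. -/
noncomputable def run (𝒜 : LocalAlgorithm Out) (G : Network) (advice : G.V → List Bool) (t : ℕ)
    (v : G.V) : Out :=
  𝒜.output (𝒜.stateAfter G advice t v)

end LocalAlgorithm

/-- A graph problem: which assignments of outputs to the nodes are valid solutions. -/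
abbrev GraphProblem (Out : Type) : Type 1 := (G : Network) → (G.V → Out) → Prop

section Schemas

variable {Out : Type}

/-- `f` is a `(𝒢, P, β, T)`-advice schema: on the graphs of `𝒢` each node gets at most `β` bits, and
some LOCAL algorithm that gets these bits solves `P` in `T` rounds on all graphs of `𝒢`. (A node
that finishes earlier keeps its output.) -/
def IsAdviceSchema (𝒢 : Set Network) (P : GraphProblem Out) (β T : ℕ) (f : AdviceMap) : Prop :=
  (∀ G ∈ 𝒢, ∀ v, (f G v).length ≤ β) ∧
  ∃ 𝒜 : LocalAlgorithm Out, ∀ G ∈ 𝒢, P G (𝒜.run G (f G) T)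

/-- On the graphs of `𝒢`, all nodes get bit-strings of the same length `L`. -/
def IsUniformFixedLength (𝒢 : Set Network) (L : ℕ) (f : AdviceMap) : Prop :=
  ∀ G ∈ 𝒢, ∀ v, (f G v).length = L

/-- For each graph of `𝒢`, the fraction of the nodes with the bit `1` among all nodes with a bit
`0` or `1` is at most `ε`. -/
def IsSparseAdvice (𝒢 : Set Network) (ε : ℝ) (f : AdviceMap) : Prop :=
  ∀ G ∈ 𝒢,
    ({v | f G v = [true]}.ncard : ℝ) /
      ({v | f G v = [false]}.ncard + {v | f G v = [true]}.ncard) ≤ ε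

/-- There is an `ε`-sparse uniform fixed-length `(𝒢, P, 1, T)`-advice schema. -/
def HasSparseOneBitSchema (𝒢 : Set Network) (P : GraphProblem Out) (ε : ℝ) (T : ℕ) : Prop :=
  ∃ f : AdviceMap,
    IsAdviceSchema 𝒢 P 1 T f ∧ IsUniformFixedLength 𝒢 1 f ∧ IsSparseAdvice 𝒢 ε f

/-- There is a `(𝒢, P, γ₀, A, T)`-composable advice schema. -/
def HasComposableSchema (𝒢 : Set Network) (P : GraphProblem Out) (γ₀ : ℕ) (A : ℝ → ℕ → ℝ)
    (T : ℕ → ℕ) : Prop :=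
  ∀ c : ℝ, 0 < c → ∀ γ : ℕ, γ₀ ≤ γ → ∀ α : ℕ, A c γ ≤ α →
    ∃ β : ℕ, (β : ℝ) ≤ c * α / (γ : ℝ) ^ 3 ∧
      ∃ f : AdviceMap,
        IsAdviceSchema 𝒢 P β (T α) f ∧
        ∀ G ∈ 𝒢, ∀ v, {u | G.graph.edist v u ≤ α ∧ f G u ≠ []}.ncard ≤ γ₀

end Schemas

/-- In an edge labeling problem each node outputs a function that maps the identifiers of its
neighbors to labels. Such outputs represent the edge labeling `χ` if both endpoints of each edge
output its label. -/
def RepresentsEdgeLabeling {C : Type} (G : Network) (out : G.V → ℕ → C)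
    (χ : G.graph.EdgeLabeling C) : Prop :=
  ∀ (u v : G.V) (h : G.graph.Adj u v), out u (G.ident v) = χ.get u v h

/-- The splitting problem: color the edges with two colors such that each node has the same number
of incident edges of the two colors. -/
def splitting : GraphProblem (ℕ → Bool) := fun G out =>
  ∃ χ : G.graph.EdgeLabeling Bool, RepresentsEdgeLabeling G out χ ∧
    ∀ v, {w | ∃ h : G.graph.Adj v w, χ.get v w h = true}.ncard =
      {w | ∃ h : G.graph.Adj v w, χ.get v w h = false}.ncard

/-- Proper edge coloring with `k` colors. -/
def edgeColoring (k : ℕ) : GraphProblem (ℕ → Fin k) := fun G out =>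
  ∃ χ : G.graph.EdgeLabeling (Fin k), RepresentsEdgeLabeling G out χ ∧
    ∀ (v w₁ w₂ : G.V) (h₁ : G.graph.Adj v w₁) (h₂ : G.graph.Adj v w₂),
      w₁ ≠ w₂ → χ.get v w₁ h₁ ≠ χ.get v w₂ h₂

/-- Bipartite graphs of maximum degree (at most) `Δ` in which all degrees are even. -/
def evenBipartite (Δ : ℕ) : Set Network :=
  {G | G.graph.IsBipartite ∧ G.graph.maxDegree ≤ Δ ∧ ∀ v, Even (G.graph.degree v)}

/-- Bipartite `Δ`-regular graphs. -/
def regularBipartite (Δ : ℕ) : Set Network :=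
  {G | G.graph.IsBipartite ∧ G.graph.IsRegularOfDegree Δ}

/-! Pair up the edges at each node. The edges then decompose into closed trails, of even length
because the graph is bipartite. If each trail is colored alternately, every pair has one edge of
each color, which is a splitting. Repeating this `k` times inside the classes obtained so far gives
`2 ^ k` labels; in a `2 ^ k`-regular graph each label occurs once at each node, which is a proper
edge coloring (`ncard_labelClass`).

The pairing is a fixed function of the set of neighbors in a class, so trails can be followed
locally. The only global information is which of its two alternating colorings a trail gets. On a
closed trail of length at most `L = 6 * l + 1`, a fixed choice of one edge from its edge set
decides: that edge is `true` (`TrailSystem.exists_normalized`). On longer trails the advice marks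
some `true` edges, so that following the trail for fewer than `L` steps meets a mark, and the parity
of the number of steps gives the color (`decodeLabel_eq`).

To be recognizable, the marks of all trails and all levels must be far apart.
`TrailSystem.exists_packing` places disjoint stretches with `l` candidates each on the long trails.
As `l` is at least four times the number of candidates near a given one,
`exists_independent_transversal` picks one candidate per stretch without conflicts
(`exists_marking`). Disjointness also bounds the number of marks by `k * |E| / l`, so a large `l`
makes the advice sparse.

In the composable schemas both endpoints of a mark hold its level in unary, and a ball meets at most
one mark; hence two bit-holding nodes per ball suffice, even for edge coloring. With one bit per
node and a single level this is already enough; with several levels, a third node encodes the level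
by its distance from the mark (`IsMarking.exists_isBeacon`, `exists_of_beaconMark`). -/

/-! ### Independent transversals by counting -/

/-- Instead of the local lemma, a direct count: each additional part multiplies the number of
conflict-free partial transversals by at least `l / 2`, so this number never drops to zero. -/
theorem exists_independent_transversal {ι X : Type*} [Fintype ι] [DecidableEq ι] [DecidableEq X]
    (P : ι → Finset X) (c : X → X → Prop) [DecidableRel c] (hc : ∀ p q, c p q → c q p) (D l : ℕ)
    (hl : 4 * D ≤ l) (hl0 : 0 < l) (hP : ∀ i, (P i).card = l)
    (hD : ∀ p, ((Finset.univ.sigma P).filter (fun q : (_ : ι) × X => c p q.2)).card ≤ D) :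
    ∃ f : ι → X, (∀ i, f i ∈ P i) ∧ ∀ i j, i ≠ j → ¬ c (f i) (f j) := by
  classical
  rcases isEmpty_or_nonempty ι with hι | ⟨⟨i₀⟩⟩
  · exact ⟨fun i => (hι.false i).elim, fun i => (hι.false i).elim, fun i => (hι.false i).elim⟩
  obtain ⟨x₀, -⟩ : (P i₀).Nonempty := Finset.card_pos.1 (by rw [hP]; exact hl0)
  -- Values outside `F` are pinned to `x₀`, so that each partial transversal on `F` is counted
  -- exactly once as a total function.
  let IT : Finset ι → Finset (ι → X) := fun F =>
    (Fintype.piFinset fun i => if i ∈ F then P i else {x₀}).filter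
      fun g => ∀ i ∈ F, ∀ j ∈ F, i ≠ j → ¬ c (g i) (g j)
  have mem_IT : ∀ F g, g ∈ IT F ↔ (∀ i ∈ F, g i ∈ P i) ∧ (∀ i, i ∉ F → g i = x₀) ∧
      ∀ i ∈ F, ∀ j ∈ F, i ≠ j → ¬ c (g i) (g j) := by
    intro F g
    simp only [IT, Finset.mem_filter, Fintype.mem_piFinset, ← and_assoc]
    refine and_congr_left fun _ => ⟨fun h => ⟨fun i hi => ?_, fun i hi => ?_⟩, fun h i => ?_⟩
    · simpa [hi] using h i
    · simpa [hi] using h i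
    · by_cases hi : i ∈ F
      · simpa [hi] using h.1 i hi
      · simpa [hi] using h.2 i hi
  have key : ∀ n, ∀ F : Finset ι, F.card = n → ∀ i, i ∉ F →
      l * (IT F).card ≤ 2 * (IT (insert i F)).card := by
    intro n
    induction n using Nat.strong_induction_on with
    | _ n ih =>
    intro F hF i hi
    -- Prescribing the value at `j` leaves at most a fraction `2 / l`: forgetting that value is
    -- injective, and the induction hypothesis applies to `F.erase j`.
    have hcell : ∀ q : (_ : ι) × X,
        l * ((IT F).filter fun g => q.1 ∈ F ∧ g q.1 = q.2).card ≤ 2 * (IT F).card := by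
      rintro ⟨j, x⟩
      by_cases hj : j ∈ F
      · have h1 := ih (F.erase j).card (by rw [← hF]; exact Finset.card_erase_lt_of_mem hj)
          (F.erase j) rfl j (Finset.notMem_erase _ _)
        rw [Finset.insert_erase hj] at h1
        refine le_trans (Nat.mul_le_mul_left _ ?_) h1
        refine Finset.card_le_card_of_injOn (fun g => Function.update g j x₀) ?_ ?_
        · intro g hg
          simp only [Finset.coe_filter, Set.mem_ofPred_eq, mem_IT] at hg
          simp only [Finset.mem_coe, mem_IT]
          obtain ⟨⟨h1, h2, h3⟩, -, h4⟩ := hg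
          refine ⟨fun a ha => ?_, fun a ha => ?_, fun a ha b hb hab => ?_⟩
          · rw [Finset.mem_erase] at ha
            rw [Function.update_of_ne ha.1]; exact h1 a ha.2
          · by_cases haj : a = j
            · subst haj; simp
            · rw [Function.update_of_ne haj]
              exact h2 a fun h => ha (Finset.mem_erase.2 ⟨haj, h⟩)
          · rw [Finset.mem_erase] at ha hb
            rw [Function.update_of_ne ha.1, Function.update_of_ne hb.1]
            exact h3 a ha.2 b hb.2 hab
        · intro g hg g' hg' h
          simp only [Finset.coe_filter, Set.mem_ofPred_eq] at hg hg'
          funext a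
          by_cases haj : a = j
          · subst haj; rw [hg.2.2, hg'.2.2]
          · have := congrFun h a
            simpa [Function.update_of_ne haj] using this
      · simp [hj]
    set N := (IT F).card with hN
    let good := ((IT F) ×ˢ (P i)).filter fun gp => ∀ j ∈ F, ¬ c gp.2 (gp.1 j)
    let bad := ((IT F) ×ˢ (P i)).filter fun gp => ¬ ∀ j ∈ F, ¬ c gp.2 (gp.1 j)
    have hsum : good.card + bad.card = N * l := by
      rw [Finset.card_filter_add_card_filter_not, Finset.card_product, hP]
    have hgood : good.card ≤ (IT (insert i F)).card := by
      refine Finset.card_le_card_of_injOn (fun gp => Function.update gp.1 i gp.2) ?_ ?_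
      · rintro ⟨g, p⟩ hg
        simp only [good, Finset.coe_filter, Set.mem_ofPred_eq, Finset.mem_product, mem_IT] at hg
        obtain ⟨⟨⟨h1, h2, h3⟩, hp⟩, h4⟩ := hg
        simp only [Finset.mem_coe, mem_IT]
        have hne : ∀ a ∈ F, a ≠ i := fun a ha h => hi (h ▸ ha)
        refine ⟨fun a ha => ?_, fun a ha => ?_, fun a ha b hb hab => ?_⟩
        · rcases Finset.mem_insert.1 ha with rfl | ha
          · simpa using hp
          · rw [Function.update_of_ne (hne a ha)]; exact h1 a ha
        · rw [Finset.mem_insert, not_or] at ha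
          rw [Function.update_of_ne ha.1]; exact h2 a ha.2
        · rcases Finset.mem_insert.1 ha with ha' | ha' <;>
            rcases Finset.mem_insert.1 hb with hb' | hb'
          · exact absurd (ha'.trans hb'.symm) hab
          · subst ha'
            simpa [Function.update_of_ne (hne b hb')] using h4 b hb'
          · subst hb'
            simpa [Function.update_of_ne (hne a ha')] using fun h => h4 a ha' (hc _ _ h)
          · simpa [Function.update_of_ne (hne a ha'), Function.update_of_ne (hne b hb')]
              using h3 a ha' b hb' hab
      · rintro ⟨g, p⟩ hg ⟨g', p'⟩ hg' h
        simp only [good, Finset.coe_filter, Set.mem_ofPred_eq, Finset.mem_product, mem_IT] at hg hg'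
        simp only at h
        refine Prod.ext (funext fun a => ?_) ?_
        · by_cases hai : a = i
          · subst hai; exact (hg.1.1.2.1 a hi).trans (hg'.1.1.2.1 a hi).symm
          · simpa [Function.update_of_ne hai] using congrFun h a
        · simpa using congrFun h i
    -- Each of the `l` choices `p` has at most `D` conflicting candidates, each of them present in
    -- at most `2 * N / l` of the transversals. So at most `2 * D * N ≤ l * N / 2` of the `l * N`
    -- extensions are bad.
    have hbad : l * bad.card ≤ l * (D * (2 * N)) := by
      let Q := fun p => (Finset.univ.sigma P).filter (fun q : (_ : ι) × X => c p q.2)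
      have hsub : bad ⊆ (P i).biUnion fun p => (Q p).biUnion fun q =>
          ((IT F).filter fun g => q.1 ∈ F ∧ g q.1 = q.2).image fun g => (g, p) := by
        rintro ⟨g, p⟩ hg
        simp only [bad, Finset.mem_filter, Finset.mem_product, not_forall, not_not] at hg
        obtain ⟨⟨hgI, hp⟩, j, hj, hcj⟩ := hg
        simp only [Finset.mem_biUnion, Finset.mem_image, Finset.mem_filter]
        refine ⟨p, hp, ⟨j, g j⟩, ?_, g, ⟨hgI, hj, rfl⟩, rfl⟩
        simp only [Q, Finset.mem_filter, Finset.mem_sigma, Finset.mem_univ, true_and]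
        exact ⟨((mem_IT _ _).1 hgI).1 j hj, hcj⟩
      calc l * bad.card ≤ l * ∑ p ∈ P i, ∑ q ∈ Q p,
            ((IT F).filter fun g => q.1 ∈ F ∧ g q.1 = q.2).card := by
            refine Nat.mul_le_mul_left _ ((Finset.card_le_card hsub).trans ?_)
            refine Finset.card_biUnion_le.trans (Finset.sum_le_sum fun p _ => ?_)
            refine Finset.card_biUnion_le.trans (Finset.sum_le_sum fun q _ => ?_)
            exact Finset.card_image_le
        _ = ∑ p ∈ P i, ∑ q ∈ Q p,
            l * ((IT F).filter fun g => q.1 ∈ F ∧ g q.1 = q.2).card := by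
            simp only [Finset.mul_sum]
        _ ≤ ∑ p ∈ P i, ∑ q ∈ Q p, 2 * N :=
            Finset.sum_le_sum fun p _ => Finset.sum_le_sum fun q _ => hcell q
        _ ≤ ∑ p ∈ P i, D * (2 * N) := by
            refine Finset.sum_le_sum fun p _ => ?_
            rw [Finset.sum_const, smul_eq_mul]
            exact Nat.mul_le_mul_right _ (hD p)
        _ = l * (D * (2 * N)) := by rw [Finset.sum_const, smul_eq_mul, hP]
    have hbad' := Nat.le_of_mul_le_mul_left hbad hl0
    nlinarith
  have hpos : ∀ F : Finset ι, 0 < (IT F).card := by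
    intro F
    induction F using Finset.induction_on with
    | empty =>
      refine Finset.card_pos.2 ⟨fun _ => x₀, (mem_IT _ _).2 ⟨by simp, by simp, by simp⟩⟩
    | insert i F hi ih =>
      have h1 := key _ F rfl i hi
      have := Nat.mul_pos hl0 ih
      omega
  obtain ⟨f, hf⟩ := Finset.card_pos.1 (hpos Finset.univ)
  rw [mem_IT] at hf
  exact ⟨f, fun i => hf.1 i (Finset.mem_univ _),
    fun i j => hf.2.2 i (Finset.mem_univ _) j (Finset.mem_univ _)⟩

/-! ### Abstract trail systems: alternating colorings and packings -/

/-- A fixed-point-free step on the oriented edges of a trail decomposition: `τ` goes on to the next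
edge of the trail, `rev` reverses an edge, `side` is the side of a bipartition on which an oriented
edge starts. -/
structure TrailSystem (D : Type*) where
  τ : D → D
  rev : D → D
  side : D → Bool
  rev_rev : ∀ d, rev (rev d) = d
  τ_rev_τ : ∀ d, τ (rev (τ d)) = rev d
  rev_ne : ∀ d, rev d ≠ d
  τ_ne_rev : ∀ d, τ d ≠ rev d
  side_τ : ∀ d, side (τ d) = !side d
  side_rev : ∀ d, side (rev d) = !side d

namespace TrailSystem

variable {D : Type*} (S : TrailSystem D)

theorem τ_injective : Function.Injective S.τ :=
  Function.LeftInverse.injective (g := fun d => S.rev (S.τ (S.rev d))) fun d => by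
    simp [S.τ_rev_τ, S.rev_rev]

theorem iterate_rev_iterate (n : ℕ) (d : D) : S.τ^[n] (S.rev (S.τ^[n] d)) = S.rev d := by
  induction n generalizing d with
  | zero => rfl
  | succ n ih =>
    rw [Function.iterate_succ_apply', Function.iterate_succ_apply, ih, S.τ_rev_τ]

/-- As `rev d = τ (rev (τ d))`, a relation `τ^[n + 2] d = rev d` can be shortened at both ends to
`τ^[n] (τ d) = rev (τ d)`, down to the excluded cases `n = 0` and `n = 1`. So no trail traverses an
edge in both directions. -/
theorem iterate_ne_rev (n : ℕ) : ∀ d, S.τ^[n] d ≠ S.rev d := by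
  induction n using Nat.twoStepInduction with
  | zero => exact fun d h => S.rev_ne d h.symm
  | one => exact S.τ_ne_rev
  | more n ih _ =>
    intro d h
    apply ih (S.τ d)
    apply S.τ_injective
    rw [S.τ_rev_τ, ← h, ← Function.iterate_succ_apply' S.τ, ← Function.iterate_succ_apply S.τ]

/-- The forward orbit. -/
def orb (d : D) : Set D := {e | ∃ n, S.τ^[n] d = e}

theorem self_mem_orb (d : D) : d ∈ S.orb d := ⟨0, rfl⟩

theorem rev_notMem_orb (d : D) : S.rev d ∉ S.orb d := fun ⟨n, hn⟩ => S.iterate_ne_rev n d hn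

variable [Finite D]

theorem exists_period (d : D) : ∃ p, 0 < p ∧ S.τ^[p] d = d := by
  obtain ⟨p, hp, h⟩ := S.τ_injective.mem_periodicPts d
  exact ⟨p, hp, h⟩

theorem orb_iterate (n : ℕ) (d : D) : S.orb (S.τ^[n] d) = S.orb d := by
  obtain ⟨p, hp, h⟩ := S.exists_period d
  ext e
  constructor
  · rintro ⟨m, rfl⟩
    exact ⟨m + n, Function.iterate_add_apply _ _ _ _⟩
  · rintro ⟨m, rfl⟩
    refine ⟨m + (p * n - n), ?_⟩
    rw [← Function.iterate_add_apply, add_assoc,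
      Nat.sub_add_cancel (Nat.le_mul_of_pos_left n hp), Function.iterate_add_apply,
      Function.IsPeriodicPt.mul_const (show Function.IsPeriodicPt S.τ p d from h) n]

theorem orb_eq_of_mem {d e : D} (h : e ∈ S.orb d) : S.orb e = S.orb d := by
  obtain ⟨n, rfl⟩ := h; exact S.orb_iterate n d

theorem orb_rev (d : D) : S.orb (S.rev d) = S.rev '' S.orb d := by
  have key : ∀ d e, e ∈ S.orb d → S.rev e ∈ S.orb (S.rev d) := by
    rintro d e ⟨n, rfl⟩
    have h : S.rev d ∈ S.orb (S.rev (S.τ^[n] d)) := ⟨n, S.iterate_rev_iterate n d⟩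
    rw [S.orb_eq_of_mem h]
    exact S.self_mem_orb _
  ext e
  constructor
  · intro h
    have := key _ _ h
    rw [S.rev_rev] at this
    exact ⟨_, this, S.rev_rev e⟩
  · rintro ⟨e, he, rfl⟩
    exact key _ _ he

/-- The orbits of `d` and `rev d` are different sets, so any well-order on the sets of oriented
edges prefers one of the two directions. -/
theorem exists_orientation : ∃ o : D → Bool, (∀ d, o (S.τ d) = o d) ∧ ∀ d, o (S.rev d) = !o d := by
  classical
  let r : Set D → Set D → Prop := WellOrderingRel
  have hτ : ∀ d, S.orb (S.τ d) = S.orb d := S.orb_iterate 1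
  refine ⟨fun d => decide (r (S.orb d) (S.orb (S.rev d))), fun d => ?_, fun d => ?_⟩
  · have h : S.orb (S.rev (S.τ d)) = S.orb (S.rev d) := by
      rw [orb_rev, orb_rev, hτ]
    simp only [hτ, h]
  · simp only [S.rev_rev]
    have hne : S.orb d ≠ S.orb (S.rev d) := fun h =>
      S.rev_notMem_orb d (h ▸ S.self_mem_orb (S.rev d))
    rcases trichotomous_of r (S.orb d) (S.orb (S.rev d)) with h | h | h
    · have := asymm_of r h
      simp [h, this]
    · exact absurd h hne
    · have := asymm_of r h
      simp [h, this]

/-- Color by whether the preferred direction leaves from a fixed side: reversal flips both `side`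
and the orientation, a step flips only `side`. -/
theorem exists_alternating : ∃ κ : D → Bool, (∀ d, κ (S.τ d) = !κ d) ∧ ∀ d, κ (S.rev d) = κ d := by
  obtain ⟨o, h1, h2⟩ := S.exists_orientation
  exact ⟨fun d => xor (S.side d) (o d), fun d => by simp [S.side_τ, h1],
    fun d => by simp [S.side_rev, h2]⟩

omit [Finite D] in
theorem alternating_iterate {κ : D → Bool} (h : ∀ d, κ (S.τ d) = !κ d) (n : ℕ) (d : D) :
    κ (S.τ^[n] d) = κ d ↔ Even n := by
  induction n with
  | zero => simp
  | succ n ih =>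
    rw [Function.iterate_succ_apply', h, Nat.even_add_one, ← ih]
    cases κ d <;> cases κ (S.τ^[n] d) <;> simp

/-- In each trail, the edge that the choice function picks from the set of all its edges can be
given the color `true`. -/
theorem exists_normalized {Y : Type*} [Nonempty Y] (E : D → Y) (hE : ∀ d, E (S.rev d) = E d)
    (hE' : ∀ d e, E d = E e → d = e ∨ d = S.rev e) :
    ∃ κ : D → Bool, (∀ d, κ (S.τ d) = !κ d) ∧ (∀ d, κ (S.rev d) = κ d) ∧
      ∀ d p L, 0 < p → p ≤ L → S.τ^[p] d = d →
        (κ d = true ↔ ∃ j < L, Even j ∧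
          E (S.τ^[j] d) = Classical.epsilon fun y => ∃ j < L, E (S.τ^[j] d) = y) := by
  classical
  obtain ⟨κ, h1, h2⟩ := S.exists_alternating
  let e₀ : D → Y := fun d => Classical.epsilon (· ∈ E '' S.orb d)
  have he₀ : ∀ d, e₀ d ∈ E '' S.orb d := fun d =>
    Classical.epsilon_spec (p := (· ∈ E '' S.orb d)) ⟨E d, d, S.self_mem_orb d, rfl⟩
  have hτ : ∀ d, e₀ (S.τ d) = e₀ d := fun d => by
    have := S.orb_iterate 1 d
    simp only [Function.iterate_one] at this
    simp only [e₀, this]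
  have hrev : ∀ d, e₀ (S.rev d) = e₀ d := fun d => by
    simp only [e₀, S.orb_rev, Set.image_image, hE]
  have hκE : ∀ d e, E d = E e → κ d = κ e := fun d e h => by
    rcases hE' d e h with rfl | rfl
    · rfl
    · exact h2 e
  choose w hw hwE using he₀
  have hpar : ∀ d j, E (S.τ^[j] d) = e₀ d → (Even j ↔ κ d = κ (w d)) := fun d j h => by
    rw [← S.alternating_iterate h1 j d, hκE _ _ (h.trans (hwE d).symm)]
    exact eq_comm
  -- The new color compares with the chosen edge of the trail, which thereby gets the color `true`.
  refine ⟨fun d => decide (κ d = κ (w d)), fun d => ?_, fun d => ?_, fun d p L hp hpL hper => ?_⟩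
  · have : κ (w (S.τ d)) = κ (w d) := hκE _ _ (by rw [hwE, hwE, hτ])
    simp only [this, h1]
    cases κ d <;> cases κ (w d) <;> rfl
  · have : κ (w (S.rev d)) = κ (w d) := hκE _ _ (by rw [hwE, hwE, hrev])
    simp only [this, h2]
  -- A walk of `L ≥ p` edges covers the whole orbit, so `Classical.epsilon` is applied to the same
  -- set as in `e₀` and returns the same edge.
  · have hset : (fun y => ∃ j < L, E (S.τ^[j] d) = y) = (· ∈ E '' S.orb d) := by
      funext y
      refine propext ⟨?_, ?_⟩
      · rintro ⟨j, -, rfl⟩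
        exact ⟨_, ⟨j, rfl⟩, rfl⟩
      · rintro ⟨_, ⟨j, rfl⟩, rfl⟩
        refine ⟨j % p, (Nat.mod_lt _ hp).trans_le hpL, ?_⟩
        rw [Function.IsPeriodicPt.iterate_mod_apply (show Function.IsPeriodicPt S.τ p d from hper)]
    rw [hset]
    change decide (κ d = κ (w d)) = true ↔ ∃ j < L, Even j ∧ E (S.τ^[j] d) = e₀ d
    rw [decide_eq_true_iff]
    constructor
    · intro h
      obtain ⟨j, hj, hjE⟩ : ∃ j < L, E (S.τ^[j] d) = e₀ d := by
        have : (fun y => ∃ j < L, E (S.τ^[j] d) = y) (e₀ d) := by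
          rw [hset]; exact ⟨w d, hw d, hwE d⟩
        exact this
      exact ⟨j, hj, (hpar d j hjE).2 h, hjE⟩
    · rintro ⟨j, -, hj, hjE⟩
      exact (hpar d j hjE).1 hj

/-- Starting points of disjoint stretches, each with `l` edges of the color `true`, such that each
long trail enters one of them soon. -/
theorem exists_packing {κ : D → Bool} (h : ∀ d, κ (S.τ d) = !κ d) {l : ℕ} (hl : 0 < l) :
    ∃ N : Set D,
      (∀ x ∈ N, κ x = true ∧ ∀ p, 0 < p → p ≤ 6 * l + 1 → S.τ^[p] x ≠ x) ∧
      (∀ x ∈ N, ∀ y ∈ N, ∀ i < l, ∀ j < l, S.τ^[2 * i] x = S.τ^[2 * j] y → x = y ∧ i = j) ∧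
      ∀ d, (∀ p, 0 < p → p ≤ 6 * l + 1 → S.τ^[p] d ≠ d) →
        ∃ x ∈ N, ∀ j < l, ∃ m < 6 * l + 1, S.τ^[m] d = S.τ^[2 * j] x := by
  classical
  let long : D → Prop := fun x => ∀ p, 0 < p → p ≤ 6 * l + 1 → S.τ^[p] x ≠ x
  let good : Set D → Prop := fun N => (∀ x ∈ N, κ x = true ∧ long x) ∧
    ∀ x ∈ N, ∀ y ∈ N, x ≠ y → ∀ m < 2 * l, S.τ^[m] x ≠ y
  -- A maximal set of starting points: the spacing `2 * l` makes the stretches disjoint, and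
  -- maximality makes them dense on the long trails.
  obtain ⟨N, hN, hmax⟩ : ∃ N, good N ∧ ∀ N', good N' → N ⊆ N' → N' ⊆ N := by
    obtain ⟨N, hN⟩ := (Set.toFinite {N | good N}).exists_maximal ⟨∅, by simp [good]⟩
    exact ⟨N, hN.1, fun N' h h' => hN.2 h h'⟩
  have inj := fun n => S.τ_injective.iterate n
  refine ⟨N, hN.1, ?_, fun d hd => ?_⟩
  · have key : ∀ x ∈ N, ∀ y ∈ N, ∀ i j, i ≤ j → j < l → S.τ^[2 * i] x = S.τ^[2 * j] y →
        x = y ∧ i = j := by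
      intro x hx y hy i j hij hj he
      obtain ⟨a, rfl⟩ := Nat.exists_eq_add_of_le hij
      rw [mul_add, Function.iterate_add_apply] at he
      have he' := inj _ he
      by_cases hxy : x = y
      · subst hxy
        refine ⟨rfl, ?_⟩
        by_contra hne
        exact (hN.1 x hx).2 (2 * a) (by omega) (by omega) he'.symm
      · exact absurd he'.symm (hN.2 y hy x hx (Ne.symm hxy) (2 * a) (by omega))
    intro x hx y hy i hi j hj he
    rcases le_total i j with hij | hij
    · exact key x hx y hy i j hij hj he
    · obtain ⟨h1, h2⟩ := key y hy x hx j i hij hi he.symm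
      exact ⟨h1.symm, h2.symm⟩
  -- The last candidate of the stretch is then reached after at most `4 * l + 2 * (l - 1)` steps.
  · suffices hs : ∃ x ∈ N, ∃ i ≤ 4 * l, S.τ^[i] d = x by
      obtain ⟨x, hx, i, hi, rfl⟩ := hs
      exact ⟨_, hx, fun j hj => ⟨2 * j + i, by omega, Function.iterate_add_apply _ _ _ _⟩⟩
    -- Looking `2 * l` steps ahead ensures that a start found shortly before `e` still does not
    -- precede `d`. The extra step `b` makes the color of `e` equal to `true`, so that `e` could
    -- join `N`.
    obtain ⟨b, hb, hbκ⟩ : ∃ b ≤ 1, κ (S.τ^[2 * l + b] d) = true := by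
      cases hk : κ (S.τ^[2 * l] d)
      · exact ⟨1, le_rfl, by rw [Function.iterate_succ_apply', h, hk]; rfl⟩
      · exact ⟨0, zero_le_one, hk⟩
    set e := S.τ^[2 * l + b] d with he
    have hlong : long e := by
      intro p hp hpL hper
      apply hd p hp hpL
      apply inj (2 * l + b)
      rw [← Function.iterate_add_apply, add_comm, Function.iterate_add_apply, ← he, hper]
    by_cases hex : ∃ x ∈ N, ∃ m < 2 * l, S.τ^[m] x = e ∨ S.τ^[m] e = x
    · obtain ⟨x, hx, m, hm, hmx | hmx⟩ := hex
      · refine ⟨x, hx, 2 * l + b - m, by omega, inj m ?_⟩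
        rw [← Function.iterate_add_apply, hmx, he,
          show m + (2 * l + b - m) = 2 * l + b by omega]
      · refine ⟨x, hx, m + (2 * l + b), by omega, ?_⟩
        rw [Function.iterate_add_apply, ← he, hmx]
    · exfalso
      push Not at hex
      have heN : e ∈ N := by
        refine hmax (insert e N) ⟨?_, ?_⟩ (Set.subset_insert _ _) (Set.mem_insert _ _)
        · intro x hx
          rcases Set.mem_insert_iff.1 hx with rfl | hx
          · exact ⟨hbκ, hlong⟩
          · exact hN.1 x hx
        · intro x hx y hy hxy m hm
          rcases Set.mem_insert_iff.1 hx with hx | hx <;>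
            rcases Set.mem_insert_iff.1 hy with hy | hy
          · exact absurd (hx.trans hy.symm) hxy
          · rw [hx]; exact (hex y hy m hm).2
          · rw [hy]; exact (hex x hx m hm).1
          · exact hN.2 x hx y hy hxy m hm
      exact (hex e heN 0 (by omega)).1 rfl

end TrailSystem

/-! ### Local views: balls and agreement -/

/-- What can be known about a network with advice: oriented edges and advice strings, in terms of
identifiers. -/
structure LocalInfo where
  edges : Set (ℕ × ℕ)
  advice : Set (ℕ × List Bool)

/-- The neighbors of a node with respect to a set of oriented edges. -/
def nbrs (E : Set (ℕ × ℕ)) (x : ℕ) : Set ℕ := {y | (x, y) ∈ E}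

/-- The nodes up to a given distance. -/
def hopBall (E : Set (ℕ × ℕ)) : ℕ → ℕ → Set ℕ
  | 0, x => {x}
  | T + 1, x => insert x (⋃ y ∈ nbrs E x, hopBall E T y)

section hopBall

variable {E : Set (ℕ × ℕ)}

theorem mem_hopBall_self (T x : ℕ) : x ∈ hopBall E T x := by
  cases T with
  | zero => rfl
  | succ T => exact Set.mem_insert _ _

theorem mem_hopBall_succ_of_nbrs {T x y z : ℕ} (hy : y ∈ nbrs E x) (hz : z ∈ hopBall E T y) :
    z ∈ hopBall E (T + 1) x := Or.inr (Set.mem_biUnion hy hz)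

theorem hopBall_trans {i j x y z : ℕ} (hy : y ∈ hopBall E i x) (hz : z ∈ hopBall E j y) :
    z ∈ hopBall E (i + j) x := by
  induction i generalizing x with
  | zero => rw [hopBall, Set.mem_singleton_iff] at hy; subst hy; simpa using hz
  | succ i ih =>
    rw [Nat.add_right_comm]
    rcases hy with rfl | hy
    · clear ih
      induction j generalizing y with
      | zero => rw [hopBall, Set.mem_singleton_iff] at hz; subst hz; exact mem_hopBall_self _ _
      | succ j ih =>
        rcases hz with rfl | hz
        · exact mem_hopBall_self _ _
        · simp only [Set.mem_iUnion] at hz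
          obtain ⟨w, hw, hz⟩ := hz
          have := ih hz
          rw [show i + (j + 1) + 1 = (i + j + 1) + 1 by ring]
          exact mem_hopBall_succ_of_nbrs hw this
    · simp only [Set.mem_iUnion] at hy
      obtain ⟨w, hw, hy⟩ := hy
      exact mem_hopBall_succ_of_nbrs hw (ih hy)

theorem hopBall_mono {i j x y : ℕ} (hij : i ≤ j) (hy : y ∈ hopBall E i x) : y ∈ hopBall E j x := by
  obtain ⟨a, rfl⟩ := Nat.exists_eq_add_of_le hij
  exact hopBall_trans hy (mem_hopBall_self a y)

theorem nbrs_subset_hopBall_one {x y : ℕ} (hy : y ∈ nbrs E x) : y ∈ hopBall E 1 x :=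
  mem_hopBall_succ_of_nbrs hy rfl

theorem hopBall_symm (hE : ∀ d ∈ E, d.swap ∈ E) {i x y : ℕ} (hy : y ∈ hopBall E i x) :
    x ∈ hopBall E i y := by
  induction i generalizing x with
  | zero => rw [hopBall, Set.mem_singleton_iff] at hy; rw [hy]; rfl
  | succ i ih =>
    rcases hy with rfl | hy
    · exact mem_hopBall_self _ _
    · simp only [Set.mem_iUnion] at hy
      obtain ⟨w, hw, hy⟩ := hy
      exact hopBall_trans (ih hy) (nbrs_subset_hopBall_one (hE _ hw))

theorem hopBall_finite_ncard {Δ : ℕ} (hf : ∀ x, (nbrs E x).Finite) (hΔ : ∀ x, (nbrs E x).ncard ≤ Δ)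
    (i x : ℕ) : (hopBall E i x).Finite ∧ (hopBall E i x).ncard ≤ (Δ + 1) ^ i := by
  induction i generalizing x with
  | zero => exact ⟨Set.finite_singleton x, by simp [hopBall]⟩
  | succ i ih =>
    have hfin : (⋃ y ∈ nbrs E x, hopBall E i y).Finite := (hf x).biUnion fun y _ => (ih y).1
    refine ⟨hfin.insert x, (Set.ncard_insert_le _ _).trans ?_⟩
    have h1 : (⋃ y ∈ nbrs E x, hopBall E i y).ncard ≤ Δ * (Δ + 1) ^ i := by
      have hc : (⋃ y ∈ nbrs E x, hopBall E i y).ncard ≤ ∑ y ∈ (hf x).toFinset, (hopBall E i y).ncard := by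
        have := Finset.set_ncard_biUnion_le (hf x).toFinset fun y => hopBall E i y
        simpa using this
      refine hc.trans ((Finset.sum_le_card_nsmul _ _ _ fun y _ => (ih y).2).trans ?_)
      rw [smul_eq_mul, ← Set.ncard_eq_toFinset_card _ (hf x)]
      exact Nat.mul_le_mul_right _ (hΔ x)
    have h2 : 1 ≤ (Δ + 1) ^ i := Nat.one_le_pow _ _ (Nat.succ_pos _)
    rw [pow_succ]
    nlinarith

end hopBall

namespace LocalInfo

def adv (S : LocalInfo) (x : ℕ) : Set (List Bool) := {w | (x, w) ∈ S.advice}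

def SameAt (S S' : LocalInfo) (x : ℕ) : Prop :=
  nbrs S.edges x = nbrs S'.edges x ∧ S.adv x = S'.adv x

/-- `S'` looks like `S` in all nodes up to a given distance from a given node. -/
def Agree (S S' : LocalInfo) : ℕ → ℕ → Prop
  | 0, x => SameAt S S' x
  | T + 1, x => SameAt S S' x ∧ ∀ y ∈ nbrs S.edges x, Agree S S' T y

variable {S S' : LocalInfo}

theorem Agree.sameAt {T x : ℕ} (h : Agree S S' T x) : SameAt S S' x := by
  cases T with
  | zero => exact h
  | succ T => exact h.1

theorem Agree.of_succ {T x : ℕ} (h : Agree S S' (T + 1) x) : Agree S S' T x := by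
  induction T generalizing x with
  | zero => exact h.1
  | succ T ih => exact ⟨h.1, fun y hy => ih (h.2 y hy)⟩

theorem Agree.mono {T T' x : ℕ} (hT : T' ≤ T) (h : Agree S S' T x) : Agree S S' T' x := by
  induction hT with
  | refl => exact h
  | step _ ih => exact ih h.of_succ

theorem Agree.hopBall_eq {T x : ℕ} (h : Agree S S' T x) : hopBall S.edges T x = hopBall S'.edges T x := by
  induction T generalizing x with
  | zero => rfl
  | succ T ih =>
    simp only [hopBall, ← h.1.1]
    rw [Set.iUnion₂_congr fun y hy => ih (h.2 y hy)]

theorem Agree.sameAt_of_mem_hopBall {T x y : ℕ} (h : Agree S S' T x) (hy : y ∈ hopBall S.edges T x) :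
    SameAt S S' y := by
  induction T generalizing x with
  | zero => rw [hopBall, Set.mem_singleton_iff] at hy; exact hy ▸ h
  | succ T ih =>
    rcases hy with rfl | hy
    · exact h.1
    · simp only [Set.mem_iUnion] at hy
      obtain ⟨z, hz, hy⟩ := hy
      exact ih (h.2 z hz) hy

end LocalInfo

/-! ### The full-information algorithm -/

/-- The oriented edges of a network. -/
def Network.edges (G : Network) : Set (ℕ × ℕ) :=
  {e | ∃ u v, G.graph.Adj u v ∧ e = (G.ident u, G.ident v)}

/-- The information in a network with advice. -/
def Network.info (G : Network) (f : G.V → List Bool) : LocalInfo where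
  edges := G.edges
  advice := {e | ∃ v, e = (G.ident v, f v)}

/-- The algorithm in which the nodes collect all available information. -/
def fullInformation {Out : Type} (F : LocalInfo → ℕ → Out) : LocalAlgorithm Out where
  State := ℕ × LocalInfo
  Msg := LocalInfo
  init _ _ ident _ advice := (ident, ⟨∅, {(ident, advice)}⟩)
  send s _ := s.2
  recv s M := (s.1, ⟨s.2.edges ∪ {e | ∃ m ∈ M, e = (s.1, m.1) ∨ e ∈ m.2.edges},
    s.2.advice ∪ {e | ∃ m ∈ M, e ∈ m.2.advice}⟩)
  output s := F s.2 s.1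

section FullInformation

variable {Out : Type} (F : LocalInfo → ℕ → Out) (G : Network) (f : G.V → List Bool)

theorem fullInformation_fst (t : ℕ) (v : G.V) :
    ((fullInformation F).stateAfter G f t v).1 = G.ident v := by
  induction t with
  | zero => rfl
  | succ t ih => exact ih

theorem fullInformation_sound (t : ℕ) (v : G.V) :
    ((fullInformation F).stateAfter G f t v).2.edges ⊆ (G.info f).edges ∧
      ((fullInformation F).stateAfter G f t v).2.advice ⊆ (G.info f).advice := by
  induction t generalizing v with
  | zero =>
    refine ⟨Set.empty_subset _, ?_⟩
    rintro _ rfl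
    exact ⟨v, rfl⟩
  | succ t ih =>
    constructor
    · rintro e (he | ⟨m, ⟨u, hu, rfl⟩, rfl | he⟩)
      · exact (ih v).1 he
      · exact ⟨v, u, hu, by rw [fullInformation_fst]⟩
      · exact (ih u).1 he
    · rintro e (he | ⟨m, ⟨u, hu, rfl⟩, he⟩)
      · exact (ih v).2 he
      · exact (ih u).2 he

theorem fullInformation_advice (t : ℕ) (v : G.V) :
    (G.ident v, f v) ∈ ((fullInformation F).stateAfter G f t v).2.advice := by
  induction t with
  | zero => rfl
  | succ t ih => exact Or.inl ih

/-- A node learns the identifiers of its neighbors from the first messages, so its own adjacency is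
known only after one round; this is the offset `t + 1`. -/
theorem sameAt_of_fullInformation (t : ℕ) (v : G.V) (K : LocalInfo)
    (h1 : ((fullInformation F).stateAfter G f (t + 1) v).2.edges ⊆ K.edges)
    (h2 : ((fullInformation F).stateAfter G f (t + 1) v).2.advice ⊆ K.advice)
    (h3 : K.edges ⊆ (G.info f).edges) (h4 : K.advice ⊆ (G.info f).advice) :
    (G.info f).SameAt K (G.ident v) := by
  refine ⟨Set.Subset.antisymm ?_ fun y hy => h3 hy, Set.Subset.antisymm ?_ fun w hw => h4 hw⟩
  · rintro y ⟨u, w, huw, he⟩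
    obtain ⟨h5, rfl⟩ := Prod.mk.inj he
    obtain rfl := G.ident_injective h5
    refine h1 (Or.inr ⟨_, ⟨w, huw, rfl⟩, Or.inl ?_⟩)
    rw [fullInformation_fst]
  · rintro w ⟨u, he⟩
    obtain ⟨h5, rfl⟩ := Prod.mk.inj he
    obtain rfl := G.ident_injective h5
    exact h2 (fullInformation_advice F G f _ _)

/-- The induction passes to the neighbors while the view stays that of the center. Hence `K` is any
knowledge between the state of `v` and the truth: the state of a neighbor one round earlier is also
contained in it. -/
theorem agree_of_fullInformation (t : ℕ) (v : G.V) (K : LocalInfo)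
    (h1 : ((fullInformation F).stateAfter G f (t + 1) v).2.edges ⊆ K.edges)
    (h2 : ((fullInformation F).stateAfter G f (t + 1) v).2.advice ⊆ K.advice)
    (h3 : K.edges ⊆ (G.info f).edges) (h4 : K.advice ⊆ (G.info f).advice) :
    (G.info f).Agree K t (G.ident v) := by
  have hsame := sameAt_of_fullInformation F G f t v K h1 h2 h3 h4
  induction t generalizing v with
  | zero => exact hsame
  | succ t ih =>
    refine ⟨hsame, ?_⟩
    rintro y ⟨u, w, huw, he⟩
    obtain ⟨h5, rfl⟩ := Prod.mk.inj he
    obtain rfl := G.ident_injective h5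
    have h6 : ((fullInformation F).stateAfter G f (t + 1) w).2.edges ⊆ K.edges := fun e he =>
      h1 (Or.inr ⟨_, ⟨w, huw, rfl⟩, Or.inr he⟩)
    have h7 : ((fullInformation F).stateAfter G f (t + 1) w).2.advice ⊆ K.advice := fun e he =>
      h2 (Or.inr ⟨_, ⟨w, huw, rfl⟩, he⟩)
    exact ih w h6 h7 (sameAt_of_fullInformation F G f t w K h6 h7 h3 h4)

/-- After `t + 1` rounds a node knows everything up to distance `t`. -/
theorem fullInformation_run (t : ℕ) (v : G.V) :
    ∃ K, (G.info f).Agree K t (G.ident v) ∧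
      (fullInformation F).run G f (t + 1) v = F K (G.ident v) := by
  refine ⟨((fullInformation F).stateAfter G f (t + 1) v).2,
    agree_of_fullInformation F G f t v _ subset_rfl subset_rfl
      (fullInformation_sound F G f _ v).1 (fullInformation_sound F G f _ v).2, ?_⟩
  conv_rhs => rw [← fullInformation_fst F G f (t + 1) v]
  rfl

end FullInformation

/-! ### Trails in a labeled bipartite graph -/

theorem exists_pairing {s : Set ℕ} (hs : s.Finite) (h : Even s.ncard) :
    ∃ f : ℕ → ℕ, ∀ x ∈ s, f x ∈ s ∧ f x ≠ x ∧ f (f x) = x := by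
  classical
  obtain ⟨m, hm⟩ := h
  have := hs.to_subtype
  obtain ⟨e⟩ : Nonempty (s ≃ Fin m × Bool) :=
    Finite.card_eq.1 (by rw [Nat.card_coe_set_eq, hm]; simp [mul_two])
  refine ⟨fun x => if hx : x ∈ s then e.symm ((e ⟨x, hx⟩).1, !(e ⟨x, hx⟩).2) else x,
    fun x hx => ?_⟩
  simp only [hx, dif_pos, Subtype.coe_prop, ne_eq, Subtype.coe_eta, Equiv.apply_symm_apply,
    Bool.not_not, Prod.mk.eta, Equiv.symm_apply_apply, true_and, and_true]
  intro h'
  have h2 := (Equiv.symm_apply_eq e).1 (Subtype.ext h' : e.symm _ = ⟨x, hx⟩)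
  have := congrArg Prod.snd h2
  simp at this

/-- A fixed-point-free pairing of the elements of a finite set with an even number of elements. -/
noncomputable def pairing (s : Set ℕ) : ℕ → ℕ :=
  Classical.epsilon fun f => ∀ x ∈ s, f x ∈ s ∧ f x ≠ x ∧ f (f x) = x

theorem pairing_spec {s : Set ℕ} (hs : s.Finite) (h : Even s.ncard) :
    ∀ x ∈ s, pairing s x ∈ s ∧ pairing s x ≠ x ∧ pairing s (pairing s x) = x :=
  Classical.epsilon_spec (exists_pairing hs h)

/-- The neighbors of `y` along the edges with label `l`. -/
def labelClass (E : Set (ℕ × ℕ)) (lab : ℕ → ℕ → ℕ) (y l : ℕ) : Set ℕ :=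
  {z | z ∈ nbrs E y ∧ lab y z = l}

/-- The next edge of a trail all edges of which have the same label. -/
noncomputable def trailStep (E : Set (ℕ × ℕ)) (lab : ℕ → ℕ → ℕ) (d : ℕ × ℕ) : ℕ × ℕ :=
  (d.2, pairing (labelClass E lab d.2 (lab d.2 d.1)) d.1)

/-- The canonical edge of a trail is at an even distance. -/
def CanonicalEven (L : ℕ) (traj : ℕ → ℕ × ℕ) : Prop :=
  ∃ j < L, Even j ∧ s((traj j).1, (traj j).2) =
    Classical.epsilon fun y => ∃ j < L, s((traj j).1, (traj j).2) = y

structure IsBipartiteEdges (E : Set (ℕ × ℕ)) (side : ℕ → Bool) : Prop where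
  finite : E.Finite
  swap_mem : ∀ d ∈ E, d.swap ∈ E
  side_snd : ∀ d ∈ E, side d.2 = !side d.1

/-- The edges of each trail get alternating colors, and the canonical edge of each short closed
trail has the color `true`. -/
structure IsTrailColoring (E : Set (ℕ × ℕ)) (L : ℕ) (lab : ℕ → ℕ → ℕ) (κ : ℕ × ℕ → Bool) :
    Prop where
  step : ∀ d ∈ E, κ (trailStep E lab d) = !κ d
  swap : ∀ d ∈ E, κ d.swap = κ d
  short : ∀ d ∈ E, ∀ p, 0 < p → p ≤ L → (trailStep E lab)^[p] d = d →
    (κ d = true ↔ CanonicalEven L fun j => (trailStep E lab)^[j] d)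

section Trails

variable {E : Set (ℕ × ℕ)} {side : ℕ → Bool} {lab : ℕ → ℕ → ℕ}

theorem IsBipartiteEdges.nbrs_finite (hE : IsBipartiteEdges E side) (x : ℕ) : (nbrs E x).Finite :=
  hE.finite.preimage (f := Prod.mk x) (Prod.mk_right_injective x).injOn

theorem IsBipartiteEdges.labelClass_finite (hE : IsBipartiteEdges E side) (y l : ℕ) :
    (labelClass E lab y l).Finite := (hE.nbrs_finite y).subset fun _ h => h.1

theorem IsBipartiteEdges.mem_labelClass (hE : IsBipartiteEdges E side) {d : ℕ × ℕ} (hd : d ∈ E) :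
    d.1 ∈ labelClass E lab d.2 (lab d.2 d.1) := ⟨hE.swap_mem d hd, rfl⟩

theorem IsBipartiteEdges.fst_ne_snd (hE : IsBipartiteEdges E side) {d : ℕ × ℕ} (hd : d ∈ E) :
    d.1 ≠ d.2 := fun h => by
  have := hE.side_snd d hd
  rw [h] at this
  cases hs : side d.2 <;> simp [hs] at this

theorem trailStep_mem (hE : IsBipartiteEdges E side)
    (hev : ∀ y l, Even (labelClass E lab y l).ncard) {d : ℕ × ℕ} (hd : d ∈ E) :
    trailStep E lab d ∈ E :=
  (pairing_spec (hE.labelClass_finite _ _) (hev _ _) _ (hE.mem_labelClass hd)).1.1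

/-- The decomposition of the edges into trails. -/
noncomputable def trailSystem (hE : IsBipartiteEdges E side)
    (hev : ∀ y l, Even (labelClass E lab y l).ncard) : TrailSystem E where
  τ d := ⟨trailStep E lab d, trailStep_mem hE hev d.2⟩
  rev d := ⟨d.1.swap, hE.swap_mem d d.2⟩
  side d := side d.1.1
  rev_rev d := rfl
  τ_rev_τ d := by
    have h := pairing_spec (hE.labelClass_finite (lab := lab) _ _) (hev _ _) _
      (hE.mem_labelClass d.2)
    apply Subtype.ext
    simp only [trailStep, Prod.fst_swap, Prod.snd_swap]
    rw [h.1.2, h.2.2]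
    rfl
  rev_ne d h := hE.fst_ne_snd d.2 (congrArg (fun e : E => e.1.2) h)
  τ_ne_rev d h := (pairing_spec (hE.labelClass_finite (lab := lab) _ _) (hev _ _) _
    (hE.mem_labelClass d.2)).2.1 (congrArg (fun e : E => e.1.2) h)
  side_τ d := hE.side_snd d d.2
  side_rev d := hE.side_snd d d.2

theorem trailSystem_iterate (hE : IsBipartiteEdges E side)
    (hev : ∀ y l, Even (labelClass E lab y l).ncard) (n : ℕ) (d : E) :
    (((trailSystem hE hev).τ^[n] d : E) : ℕ × ℕ) = (trailStep E lab)^[n] d := by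
  induction n with
  | zero => rfl
  | succ n ih =>
    rw [Function.iterate_succ_apply', Function.iterate_succ_apply', ← ih]
    rfl

theorem trailStep_iterate_mem (hE : IsBipartiteEdges E side)
    (hev : ∀ y l, Even (labelClass E lab y l).ncard) {d : ℕ × ℕ} (hd : d ∈ E) (n : ℕ) :
    (trailStep E lab)^[n] d ∈ E := by
  rw [← trailSystem_iterate hE hev n ⟨d, hd⟩]
  exact Subtype.coe_prop _

theorem exists_isTrailColoring (hE : IsBipartiteEdges E side)
    (hev : ∀ y l, Even (labelClass E lab y l).ncard) (L : ℕ) :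
    ∃ κ, IsTrailColoring E L lab κ := by
  classical
  have := hE.finite.to_subtype
  obtain ⟨κ, h1, h2, h3⟩ := (trailSystem hE hev).exists_normalized
    (fun d : E => s(d.1.1, d.1.2)) (fun d => Sym2.eq_swap) (fun d e h => by
      rcases Sym2.eq_iff.1 h with h | h
      · exact Or.inl (Subtype.ext (Prod.ext h.1 h.2))
      · exact Or.inr (Subtype.ext (Prod.ext h.1 h.2)))
  refine ⟨fun d => if hd : d ∈ E then κ ⟨d, hd⟩ else false, fun d hd => ?_, fun d hd => ?_,
    fun d hd p hp hpL hper => ?_⟩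
  · simp only [hd, trailStep_mem hE hev hd, dif_pos]
    exact h1 ⟨d, hd⟩
  · simp only [hd, hE.swap_mem d hd, dif_pos]
    exact h2 ⟨d, hd⟩
  · simp only [hd, dif_pos]
    have h := h3 ⟨d, hd⟩ p L hp hpL (Subtype.ext (by rw [trailSystem_iterate, hper]))
    simpa only [trailSystem_iterate, CanonicalEven] using h

theorem IsTrailColoring.iterate (hE : IsBipartiteEdges E side)
    (hev : ∀ y l, Even (labelClass E lab y l).ncard) {L : ℕ} {κ : ℕ × ℕ → Bool}
    (h : IsTrailColoring E L lab κ) {d : ℕ × ℕ} (hd : d ∈ E) (n : ℕ) :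
    κ ((trailStep E lab)^[n] d) = κ d ↔ Even n := by
  have := (trailSystem hE hev).alternating_iterate (κ := fun d => κ d) (fun d => h.step d d.2) n
    ⟨d, hd⟩
  rwa [trailSystem_iterate] at this

theorem IsTrailColoring.exists_packing (hE : IsBipartiteEdges E side)
    (hev : ∀ y l, Even (labelClass E lab y l).ncard) {L : ℕ} {κ : ℕ × ℕ → Bool}
    (h : IsTrailColoring E L lab κ) {l : ℕ} (hl : 0 < l) :
    ∃ N ⊆ E,
      (∀ x ∈ N, κ x = true ∧ ∀ p, 0 < p → p ≤ 6 * l + 1 → (trailStep E lab)^[p] x ≠ x) ∧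
      (∀ x ∈ N, ∀ y ∈ N, ∀ i < l, ∀ j < l,
        (trailStep E lab)^[2 * i] x = (trailStep E lab)^[2 * j] y → x = y ∧ i = j) ∧
      ∀ d ∈ E, (∀ p, 0 < p → p ≤ 6 * l + 1 → (trailStep E lab)^[p] d ≠ d) →
        ∃ x ∈ N, ∀ j < l, ∃ m < 6 * l + 1,
          (trailStep E lab)^[m] d = (trailStep E lab)^[2 * j] x := by
  have := hE.finite.to_subtype
  obtain ⟨N, h1, h2, h3⟩ := (trailSystem hE hev).exists_packing (κ := fun d => κ d)
    (fun d => h.step d d.2) hl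
  refine ⟨Subtype.val '' N, ?_, ?_, ?_, ?_⟩
  · rintro _ ⟨x, -, rfl⟩
    exact x.2
  · rintro _ ⟨x, hx, rfl⟩
    refine ⟨(h1 x hx).1, fun p hp hpL he => (h1 x hx).2 p hp hpL (Subtype.ext ?_)⟩
    rw [trailSystem_iterate, he]
  · rintro _ ⟨x, hx, rfl⟩ _ ⟨y, hy, rfl⟩ i hi j hj he
    obtain ⟨h4, h5⟩ := h2 x hx y hy i hi j hj
      (Subtype.ext (by rw [trailSystem_iterate, trailSystem_iterate, he]))
    exact ⟨congrArg _ h4, h5⟩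
  · intro d hd hlong
    obtain ⟨x, hx, h4⟩ := h3 ⟨d, hd⟩ fun p hp hpL he => hlong p hp hpL (by
      have := congrArg Subtype.val he
      rwa [trailSystem_iterate] at this)
    refine ⟨x, ⟨x, hx, rfl⟩, fun j hj => ?_⟩
    obtain ⟨m, hm, he⟩ := h4 j hj
    refine ⟨m, hm, ?_⟩
    have := congrArg Subtype.val he
    rwa [trailSystem_iterate, trailSystem_iterate] at this

/-- A trail coloring splits each label class in two halves. -/
theorem IsTrailColoring.two_mul_ncard (hE : IsBipartiteEdges E side)
    (hev : ∀ y l, Even (labelClass E lab y l).ncard) {L : ℕ} {κ : ℕ × ℕ → Bool}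
    (h : IsTrailColoring E L lab κ) (y l : ℕ) (b : Bool) :
    2 * {z | z ∈ labelClass E lab y l ∧ κ (y, z) = b}.ncard = (labelClass E lab y l).ncard := by
  have hfin := hE.labelClass_finite (lab := lab) y l
  have hp := pairing_spec hfin (hev y l)
  have hflip : ∀ z ∈ labelClass E lab y l,
      κ (y, pairing (labelClass E lab y l) z) = !κ (y, z) := by
    intro z hz
    have hz' : (z, y) ∈ E := hE.swap_mem _ hz.1
    have h1 := h.step _ hz'
    rw [← h.swap _ hz'] at h1
    simpa only [trailStep, hz.2, Prod.swap_prod_mk] using h1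
  -- The pairing at `y` joins consecutive edges of a trail, so it maps each color class injectively
  -- into the other one.
  have hle : ∀ b, {z | z ∈ labelClass E lab y l ∧ κ (y, z) = b}.ncard ≤
      {z | z ∈ labelClass E lab y l ∧ κ (y, z) = !b}.ncard := by
    intro b
    refine Set.ncard_le_ncard_of_injOn (pairing (labelClass E lab y l)) ?_ ?_
      (hfin.subset fun _ h => h.1)
    · rintro z ⟨hz, rfl⟩
      exact ⟨(hp z hz).1, hflip z hz⟩
    · rintro z ⟨hz, -⟩ w ⟨hw, -⟩ he
      rw [← (hp z hz).2.2, he, (hp w hw).2.2]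
  have heq : {z | z ∈ labelClass E lab y l ∧ κ (y, z) = b}.ncard =
      {z | z ∈ labelClass E lab y l ∧ κ (y, z) = !b}.ncard :=
    le_antisymm (hle b) (by simpa using hle (!b))
  have hunion : labelClass E lab y l = {z | z ∈ labelClass E lab y l ∧ κ (y, z) = b} ∪
      {z | z ∈ labelClass E lab y l ∧ κ (y, z) = !b} := by
    ext z
    simp only [Set.mem_union, Set.mem_ofPred_eq, ← and_or_left]
    refine ⟨fun hz => ⟨hz, ?_⟩, fun hz => hz.1⟩
    cases κ (y, z) <;> cases b <;> simp
  have hdisj : Disjoint {z | z ∈ labelClass E lab y l ∧ κ (y, z) = b}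
      {z | z ∈ labelClass E lab y l ∧ κ (y, z) = !b} := by
    rw [Set.disjoint_left]
    rintro z ⟨-, h1⟩ ⟨-, h2⟩
    rw [h1] at h2
    cases b <;> simp at h2
  conv_rhs => rw [hunion]
  rw [Set.ncard_union_eq hdisj (hfin.subset fun _ h => h.1) (hfin.subset fun _ h => h.1), ← heq,
    two_mul]

end Trails

/-! ### Iterated splitting -/

/-- The coloring of the edges within each label class. -/
noncomputable def trailColor (E : Set (ℕ × ℕ)) (L : ℕ) (lab : ℕ → ℕ → ℕ) : ℕ × ℕ → Bool :=
  Classical.epsilon (IsTrailColoring E L lab)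

/-- The labels after a number of splitting steps. -/
noncomputable def splitLabel (E : Set (ℕ × ℕ)) (L : ℕ) : ℕ → ℕ → ℕ → ℕ
  | 0 => fun _ _ => 0
  | i + 1 => fun x y =>
      2 * splitLabel E L i x y + (trailColor E L (splitLabel E L i) (x, y)).toNat

section SplitLabel

variable {E : Set (ℕ × ℕ)} {side : ℕ → Bool} {k : ℕ}

theorem even_ncard_of_pow_dvd {lab : ℕ → ℕ → ℕ} {i : ℕ} (hi : i < k)
    (hk : ∀ x, 2 ^ k ∣ (nbrs E x).ncard) (h1 : ∀ d ∈ E, lab d.1 d.2 < 2 ^ i)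
    (h2 : ∀ x, ∀ l < 2 ^ i, 2 ^ i * (labelClass E lab x l).ncard = (nbrs E x).ncard) (y l : ℕ) :
    Even (labelClass E lab y l).ncard := by
  by_cases hl : l < 2 ^ i
  · have h3 := hk y
    rw [← h2 y l hl, show k = i + (k - i) by omega, pow_add] at h3
    have h4 := Nat.dvd_of_mul_dvd_mul_left (by positivity) h3
    exact even_iff_two_dvd.2 (dvd_trans (dvd_pow_self 2 (by omega)) h4)
  · have : labelClass E lab y l = ∅ := by
      ext z
      simp only [labelClass, Set.mem_ofPred_eq, Set.mem_empty_iff_false, iff_false, not_and]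
      rintro hz rfl
      exact hl (h1 _ hz)
    simp [this]

/-- Each round halves every class at each node. As `2 ^ k` divides the degrees, the classes remain
even, and can be split again, as long as `i < k`. -/
theorem ncard_labelClass (hE : IsBipartiteEdges E side) (L : ℕ)
    (hk : ∀ x, 2 ^ k ∣ (nbrs E x).ncard) (i : ℕ) (hi : i ≤ k) :
    (∀ d ∈ E, splitLabel E L i d.2 d.1 = splitLabel E L i d.1 d.2 ∧
      splitLabel E L i d.1 d.2 < 2 ^ i) ∧
    ∀ x, ∀ l < 2 ^ i, 2 ^ i * (labelClass E (splitLabel E L i) x l).ncard = (nbrs E x).ncard := by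
  induction i with
  | zero =>
    refine ⟨fun d _ => ⟨rfl, by simp [splitLabel]⟩, fun x l hl => ?_⟩
    obtain rfl : l = 0 := by simpa using hl
    simp [labelClass, splitLabel]
  | succ i ih =>
    obtain ⟨h1, h2⟩ := ih (by omega)
    have hev := even_ncard_of_pow_dvd (by omega) hk (fun d hd => (h1 d hd).2) h2
    have hκ : IsTrailColoring E L (splitLabel E L i) (trailColor E L (splitLabel E L i)) :=
      Classical.epsilon_spec (exists_isTrailColoring hE hev L)
    refine ⟨fun d hd => ⟨?_, ?_⟩, fun x l hl => ?_⟩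
    · have := hκ.swap d hd
      simp only [splitLabel, (h1 d hd).1]
      rw [← this]; rfl
    · have := (h1 d hd).2
      have hb := Bool.toNat_le (trailColor E L (splitLabel E L i) (d.1, d.2))
      simp only [splitLabel, pow_succ]
      omega
    · have hset : labelClass E (splitLabel E L (i + 1)) x l =
          {z | z ∈ labelClass E (splitLabel E L i) x (l / 2) ∧
            trailColor E L (splitLabel E L i) (x, z) = decide (l % 2 = 1)} := by
        ext z
        simp only [labelClass, splitLabel, Set.mem_ofPred_eq, and_assoc]
        refine and_congr_right fun _ => ?_
        cases trailColor E L (splitLabel E L i) (x, z) <;> simp <;> omega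
      rw [hset, pow_succ, mul_assoc, hκ.two_mul_ncard hE hev,
        h2 x (l / 2) (by rw [pow_succ] at hl; omega)]

theorem even_ncard_labelClass (hE : IsBipartiteEdges E side) (L : ℕ)
    (hk : ∀ x, 2 ^ k ∣ (nbrs E x).ncard) {i : ℕ} (hi : i < k) (y l : ℕ) :
    Even (labelClass E (splitLabel E L i) y l).ncard := by
  obtain ⟨h1, h2⟩ := ncard_labelClass hE L hk i hi.le
  exact even_ncard_of_pow_dvd hi hk (fun d hd => (h1 d hd).2) h2 y l

theorem isTrailColoring_trailColor (hE : IsBipartiteEdges E side) (L : ℕ)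
    (hk : ∀ x, 2 ^ k ∣ (nbrs E x).ncard) {i : ℕ} (hi : i < k) :
    IsTrailColoring E L (splitLabel E L i) (trailColor E L (splitLabel E L i)) :=
  Classical.epsilon_spec (exists_isTrailColoring hE (even_ncard_labelClass hE L hk hi) L)

end SplitLabel

/-! ### Decoding the labels from marks -/

/-- The color that the marked edges on a trail, or else its canonical edge, give to its first
edge. -/
def DecodedTrue (L : ℕ) (M : ℕ × ℕ → Prop) (traj : ℕ → ℕ × ℕ) : Prop :=
  (∃ j < L, Even j ∧ M (traj j)) ∨ ((∀ j < L, ¬ M (traj j)) ∧ CanonicalEven L traj)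

theorem CanonicalEven.congr {L : ℕ} {traj traj' : ℕ → ℕ × ℕ} (h : ∀ j < L, traj j = traj' j) :
    CanonicalEven L traj ↔ CanonicalEven L traj' := by
  have h2 : (fun y => ∃ j < L, s((traj j).1, (traj j).2) = y) =
      fun y => ∃ j < L, s((traj' j).1, (traj' j).2) = y := by
    funext y
    refine propext (exists_congr fun j => and_congr_right fun hj => ?_)
    rw [h j hj]
  unfold CanonicalEven
  rw [h2]
  refine exists_congr fun j => and_congr_right fun hj => ?_
  rw [h j hj]

theorem DecodedTrue.congr {L : ℕ} {M M' : ℕ × ℕ → Prop} {traj traj' : ℕ → ℕ × ℕ}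
    (h : ∀ j < L, traj j = traj' j) (hM : ∀ j < L, M (traj j) ↔ M' (traj j)) :
    DecodedTrue L M traj ↔ DecodedTrue L M' traj' := by
  refine or_congr (exists_congr fun j => and_congr_right fun hj => ?_)
    (and_congr (forall₂_congr fun j hj => ?_) (CanonicalEven.congr h))
  · rw [hM j hj, h j hj]
  · rw [hM j hj, h j hj]

open Classical in
/-- The labels that a node computes from what it knows. -/
noncomputable def decodeLabel (mark : LocalInfo → ℕ → ℕ × ℕ → Prop) (L : ℕ) (S : LocalInfo) :
    ℕ → ℕ → ℕ → ℕ
  | 0 => fun _ _ => 0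
  | i + 1 => fun x y => 2 * decodeLabel mark L S i x y +
      if DecodedTrue L (mark S i)
        (fun j => (trailStep S.edges (decodeLabel mark L S i))^[j] (x, y)) then 1 else 0

/-- By induction on the level, each level costing `L` in the radius, since a trail of the true
labeling is followed for `L` edges. Marked edges are `true`, so a mark after `j` steps gives the
color by the parity of `j`, whichever mark is used. Without a mark the trail must close up within
`L` steps, and its canonical edge decides. -/
theorem decodeLabel_eq {S : LocalInfo} {side : ℕ → Bool} {k L r : ℕ}
    {mark : LocalInfo → ℕ → ℕ × ℕ → Prop} (hE : IsBipartiteEdges S.edges side)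
    (hk : ∀ x, 2 ^ k ∣ (nbrs S.edges x).ncard)
    (hloc : ∀ S', ∀ i < k, ∀ d ∈ S.edges, S.Agree S' r d.1 → (mark S i d ↔ mark S' i d))
    (hsound : ∀ i < k, ∀ d ∈ S.edges, mark S i d →
      trailColor S.edges L (splitLabel S.edges L i) d = true)
    (hcomplete : ∀ i < k, ∀ d ∈ S.edges,
      (∀ p, 0 < p → p ≤ L → (trailStep S.edges (splitLabel S.edges L i))^[p] d ≠ d) →
        ∃ m < L, mark S i ((trailStep S.edges (splitLabel S.edges L i))^[m] d))
    {i : ℕ} (hi : i ≤ k) {S' : LocalInfo} {x y : ℕ} (hA : S.Agree S' (r + i * L) x)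
    (hxy : (x, y) ∈ S.edges) :
    decodeLabel mark L S' i x y = splitLabel S.edges L i x y := by
  induction i generalizing x y with
  | zero => rfl
  | succ i ih =>
    set lab := splitLabel S.edges L i with hlab
    have hev := even_ncard_labelClass hE L hk (show i < k by omega)
    have hκ := isTrailColoring_trailColor hE L hk (show i < k by omega)
    rw [← hlab] at hev hκ
    have hmem : ∀ j, (trailStep S.edges lab)^[j] (x, y) ∈ S.edges :=
      trailStep_iterate_mem hE hev hxy
    -- After `j` steps a surplus radius `L - j` is left; the remaining `r + i * L` serves to decode
    -- the lower level and to recognize marks.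
    have htraj : ∀ j < L, (trailStep S.edges lab)^[j] (x, y) =
        (trailStep S'.edges (decodeLabel mark L S' i))^[j] (x, y) ∧
        S.Agree S' (r + i * L + (L - j)) ((trailStep S.edges lab)^[j] (x, y)).1 := by
      intro j
      induction j with
      | zero =>
        intro _
        refine ⟨rfl, ?_⟩
        rw [add_mul, one_mul, ← add_assoc] at hA
        exact hA
      | succ j ihj =>
        intro hj
        obtain ⟨h1, h2⟩ := ihj (by omega)
        have hd := hmem j
        rw [Function.iterate_succ_apply', Function.iterate_succ_apply', ← h1]
        set d := (trailStep S.edges lab)^[j] (x, y)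
        have hA2 : S.Agree S' (r + i * L + (L - (j + 1))) d.2 := by
          rw [show r + i * L + (L - j) = r + i * L + (L - (j + 1)) + 1 by omega] at h2
          exact h2.2 _ hd
        refine ⟨?_, hA2⟩
        have hlab' : ∀ z ∈ nbrs S.edges d.2, decodeLabel mark L S' i d.2 z = lab d.2 z :=
          fun z hz => ih (by omega) (hA2.mono (by omega)) hz
        simp only [trailStep]
        rw [hlab' _ (hE.swap_mem d hd)]
        -- `pairing` depends only on the class as a set, so equal classes yield the same next edge.
        have : labelClass S.edges lab d.2 (lab d.2 d.1) =
            labelClass S'.edges (decodeLabel mark L S' i) d.2 (lab d.2 d.1) := by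
          ext z
          simp only [labelClass, Set.mem_ofPred_eq, ← hA2.sameAt.1]
          refine and_congr_right fun hz => ?_
          rw [hlab' z hz]
        rw [this]
    have hcol : DecodedTrue L (mark S' i)
        (fun j => (trailStep S'.edges (decodeLabel mark L S' i))^[j] (x, y)) ↔
        trailColor S.edges L lab (x, y) = true := by
      rw [← DecodedTrue.congr (M := mark S i) (traj := fun j => (trailStep S.edges lab)^[j] (x, y))
        (fun j hj => (htraj j hj).1)
        (fun j hj => hloc S' i (by omega) _ (hmem j) ((htraj j hj).2.mono (by omega)))]
      have hpar : ∀ j, mark S i ((trailStep S.edges lab)^[j] (x, y)) →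
          (trailColor S.edges L lab (x, y) = true ↔ Even j) := fun j hj => by
        rw [← hκ.iterate hE hev hxy j, hsound i (by omega) _ (hmem j) hj]
        exact eq_comm
      by_cases hm : ∃ j < L, mark S i ((trailStep S.edges lab)^[j] (x, y))
      · obtain ⟨j, hj, hm⟩ := hm
        constructor
        · rintro (⟨j', -, hj', hm'⟩ | ⟨h, -⟩)
          · exact (hpar j' hm').2 hj'
          · exact absurd hm (h j hj)
        · intro h
          exact Or.inl ⟨j, hj, (hpar j hm).1 h, hm⟩
      · obtain ⟨p, hp, hpL, hper⟩ : ∃ p, 0 < p ∧ p ≤ L ∧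
            (trailStep S.edges lab)^[p] (x, y) = (x, y) := by
          by_contra hno
          push Not at hno
          exact hm (hcomplete i (by omega) _ hxy hno)
        rw [hκ.short _ hxy p hp hpL hper]
        push Not at hm
        exact ⟨fun h => h.elim (fun ⟨j, hj, _, hm'⟩ => absurd hm' (hm j hj)) (·.2),
          fun h => Or.inr ⟨hm, h⟩⟩
    simp only [decodeLabel, splitLabel]
    rw [ih (by omega) (hA.mono (by gcongr; omega)) hxy, ← hlab]
    by_cases hc : trailColor S.edges L lab (x, y) = true
    · rw [if_pos (hcol.2 hc), hc]; rfl
    · rw [if_neg fun h => hc (hcol.1 h), Bool.eq_false_of_not_eq_true hc]; rfl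

/-! ### Existence of sparse markings -/

theorem IsBipartiteEdges.exists_edges_from_hopBall {E : Set (ℕ × ℕ)} {side : ℕ → Bool} {Δ : ℕ}
    (hE : IsBipartiteEdges E side) (hΔ : ∀ x, (nbrs E x).ncard ≤ Δ) (ρ x : ℕ) :
    ∃ B : Finset (ℕ × ℕ), B.card ≤ (Δ + 1) ^ ρ * Δ ∧ ∀ d ∈ E, d.1 ∈ hopBall E ρ x → d ∈ B := by
  classical
  obtain ⟨hbf, hbc⟩ := hopBall_finite_ncard hE.nbrs_finite hΔ ρ x
  refine ⟨hbf.toFinset.biUnion fun x => (hE.nbrs_finite x).toFinset.image fun y => (x, y),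
    ?_, fun d hd hdx => ?_⟩
  · refine Finset.card_biUnion_le.trans ((Finset.sum_le_card_nsmul _ _ Δ fun x _ => ?_).trans ?_)
    · refine Finset.card_image_le.trans ?_
      rw [← Set.ncard_eq_toFinset_card _ (hE.nbrs_finite x)]
      exact hΔ x
    · rw [smul_eq_mul, ← Set.ncard_eq_toFinset_card _ hbf]
      exact Nat.mul_le_mul_right _ hbc
  · simp only [Finset.mem_biUnion, Set.Finite.mem_toFinset, Finset.mem_image]
    exact ⟨d.1, hdx, d.2, hd, rfl⟩

/-- A set of marked edges of the color `true`, each of them with its level: there is one in each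
stretch of each long trail, and they are far away from each other. -/
structure IsMarking (E : Set (ℕ × ℕ)) (k ρ l : ℕ) (C : Finset (ℕ × ℕ × ℕ)) : Prop where
  level_lt : ∀ c ∈ C, c.1 < k
  mem : ∀ c ∈ C, c.2 ∈ E
  color : ∀ c ∈ C, trailColor E (6 * l + 1) (splitLabel E (6 * l + 1) c.1) c.2 = true
  long : ∀ c ∈ C, ∀ p, 0 < p → p ≤ 6 * l + 1 →
    (trailStep E (splitLabel E (6 * l + 1) c.1))^[p] c.2 ≠ c.2
  far : ∀ c ∈ C, ∀ c' ∈ C, c'.2.1 ∈ hopBall E ρ c.2.1 → c = c'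
  hit : ∀ i < k, ∀ d ∈ E,
    (∀ p, 0 < p → p ≤ 6 * l + 1 → (trailStep E (splitLabel E (6 * l + 1) i))^[p] d ≠ d) →
      ∃ m < 6 * l + 1, (i, (trailStep E (splitLabel E (6 * l + 1) i))^[m] d) ∈ C
  card_mul_le : C.card * l ≤ k * E.ncard

/-- An independent transversal of the stretches of all levels, two edges being in conflict if their
first nodes are within distance `ρ`. An edge conflicts with at most `(Δ + 1) ^ ρ * Δ` oriented
edges, each of which is a candidate at most once per level. -/
theorem exists_marking {E : Set (ℕ × ℕ)} {side : ℕ → Bool} {k Δ ρ l : ℕ}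
    (hE : IsBipartiteEdges E side) (hk : ∀ x, 2 ^ k ∣ (nbrs E x).ncard)
    (hΔ : ∀ x, (nbrs E x).ncard ≤ Δ) (hl0 : 0 < l)
    (hl : 4 * (k * ((Δ + 1) ^ ρ * Δ)) ≤ l) : ∃ C, IsMarking E k ρ l C := by
  classical
  set L := 6 * l + 1 with hL
  have hev : ∀ i : Fin k, ∀ y m, Even (labelClass E (splitLabel E L i) y m).ncard :=
    fun i => even_ncard_labelClass hE L hk i.2
  have hκ : ∀ i : Fin k, IsTrailColoring E L (splitLabel E L i) (trailColor E L (splitLabel E L i)) :=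
    fun i => isTrailColoring_trailColor hE L hk i.2
  choose N hNE hN1 hN2 hN3 using fun i => (hκ i).exists_packing hE (hev i) hl0
  have hNfin : ∀ i, (N i).Finite := fun i => hE.finite.subset (hNE i)
  let st : Fin k → ℕ × ℕ → ℕ × ℕ := fun i => trailStep E (splitLabel E L i)
  have hst : ∀ (i : Fin k) d, d ∈ E → ∀ n, (st i)^[n] d ∈ E := fun i d hd n =>
    trailStep_iterate_mem hE (hev i) hd n
  let ι := (i : Fin k) × (hNfin i).toFinset
  let P : ι → Finset (ℕ × ℕ) := fun a => (Finset.range l).image fun j => (st a.1)^[2 * j] a.2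
  have hmemN : ∀ a : ι, (a.2 : ℕ × ℕ) ∈ N a.1 := fun a => (hNfin a.1).mem_toFinset.1 a.2.2
  have hPcard : ∀ a, (P a).card = l := by
    intro a
    rw [Finset.card_image_of_injOn, Finset.card_range]
    intro i hi j hj he
    exact (hN2 a.1 _ (hmemN a) _ (hmemN a) i (by simpa using hi) j (by simpa using hj) he).2
  have hPE : ∀ a, ∀ q ∈ P a, q ∈ E := by
    intro a q hq
    obtain ⟨j, -, rfl⟩ := Finset.mem_image.1 hq
    exact hst _ _ (hNE _ (hmemN a)) _
  -- Stretches of the same level are disjoint, so level and edge determine the stretch. This bounds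
  -- the conflicts and, at the end, the number of marks.
  have hinj : Set.InjOn (fun q : (_ : ι) × (ℕ × ℕ) => (q.1.1, q.2)) (Finset.univ.sigma P) := by
    rintro ⟨⟨i, x⟩, q⟩ hq ⟨⟨i', x'⟩, q'⟩ hq' he
    obtain ⟨rfl, rfl⟩ := Prod.mk.inj he
    simp only [Finset.coe_sigma, Set.mem_sigma_iff, Finset.mem_coe, Finset.mem_univ, true_and] at hq hq'
    obtain ⟨j, hj, hjq⟩ := Finset.mem_image.1 hq
    obtain ⟨j', hj', hjq'⟩ := Finset.mem_image.1 hq'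
    have := (hN2 i _ (hmemN ⟨i, x⟩) _ (hmemN ⟨i, x'⟩) j (by simpa using hj) j' (by simpa using hj')
      (hjq.trans hjq'.symm)).1
    obtain rfl : x = x' := Subtype.ext this
    rfl
  let c : ℕ × ℕ → ℕ × ℕ → Prop := fun p q => q.1 ∈ hopBall E ρ p.1
  have hcount : ∀ p, ((Finset.univ.sigma P).filter
      (fun q : (_ : ι) × (ℕ × ℕ) => c p q.2)).card ≤ k * ((Δ + 1) ^ ρ * Δ) := by
    intro p
    obtain ⟨B, hB, hBmem⟩ := hE.exists_edges_from_hopBall hΔ ρ p.1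
    have := Finset.card_le_card_of_injOn (s := (Finset.univ.sigma P).filter
      (fun q : (_ : ι) × (ℕ × ℕ) => c p q.2)) (t := (Finset.univ : Finset (Fin k)) ×ˢ B)
      (fun q => (q.1.1, q.2)) (fun q hq => ?_) 
      (hinj.mono (Finset.coe_subset.2 (Finset.filter_subset _ _)))
    · refine this.trans ?_
      rw [Finset.card_product, Finset.card_univ, Fintype.card_fin]
      exact Nat.mul_le_mul_left _ hB
    · simp only [Finset.coe_filter, Finset.mem_sigma, Finset.mem_univ, true_and,
        Set.mem_ofPred_eq] at hq
      simp only [Finset.coe_product, Set.mem_prod, Finset.mem_coe, Finset.mem_univ, true_and]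
      exact hBmem _ (hPE _ _ hq.1) hq.2
  obtain ⟨g, hg1, hg2⟩ := exists_independent_transversal P c
    (fun p q h => hopBall_symm hE.swap_mem h) _ l hl hl0 hPcard hcount
  refine ⟨Finset.univ.image fun a : ι => ((a.1 : ℕ), g a), ?_, ?_, ?_, ?_, ?_, ?_, ?_⟩
  · intro q hq
    obtain ⟨a, -, rfl⟩ := Finset.mem_image.1 hq
    exact a.1.2
  · intro q hq
    obtain ⟨a, -, rfl⟩ := Finset.mem_image.1 hq
    exact hPE a _ (hg1 a)
  · intro q hq
    obtain ⟨a, -, rfl⟩ := Finset.mem_image.1 hq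
    obtain ⟨j, -, hj⟩ := Finset.mem_image.1 (hg1 a)
    simp only [← hj]
    rw [(hκ a.1).iterate hE (hev a.1) (hNE _ (hmemN a)) (2 * j) |>.2 (by simp)]
    exact (hN1 a.1 _ (hmemN a)).1
  · intro q hq p hp hpL he
    obtain ⟨a, -, rfl⟩ := Finset.mem_image.1 hq
    obtain ⟨j, -, hj⟩ := Finset.mem_image.1 (hg1 a)
    simp only [← hj] at he
    apply (hN1 a.1 _ (hmemN a)).2 p hp hpL
    -- Cancelling the `2 * j` steps moves a short period from the candidate back to the start of its
    -- stretch.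
    have hinj2 := ((trailSystem hE (hev a.1)).τ_injective.iterate (2 * j))
    have h5 := @hinj2 ((trailSystem hE (hev a.1)).τ^[p] ⟨a.2, hNE _ (hmemN a)⟩)
      ⟨a.2, hNE _ (hmemN a)⟩ (by
        apply Subtype.ext
        rw [← Function.iterate_add_apply, add_comm, Function.iterate_add_apply,
          trailSystem_iterate, trailSystem_iterate]
        exact he)
    have h6 := congrArg Subtype.val h5
    rwa [trailSystem_iterate] at h6
  · intro q hq q' hq' hb
    obtain ⟨a, -, rfl⟩ := Finset.mem_image.1 hq
    obtain ⟨a', -, rfl⟩ := Finset.mem_image.1 hq'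
    by_cases haa : a = a'
    · rw [haa]
    · exact absurd hb (hg2 a a' haa)
  · intro i hi d hd hlong
    obtain ⟨x, hx, h⟩ := hN3 ⟨i, hi⟩ d hd hlong
    let a : ι := ⟨⟨i, hi⟩, ⟨x, (hNfin _).mem_toFinset.2 hx⟩⟩
    obtain ⟨j, hj, hja⟩ := Finset.mem_image.1 (hg1 a)
    obtain ⟨m, hm, hme⟩ := h j (by simpa using hj)
    refine ⟨m, hm, Finset.mem_image.2 ⟨a, Finset.mem_univ _, ?_⟩⟩
    rw [← hja, hme]
  · have h1 : (Finset.univ.sigma P).card = Fintype.card ι * l := by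
      rw [Finset.card_sigma, Finset.sum_congr rfl fun a _ => hPcard a, Finset.sum_const,
        smul_eq_mul, Finset.card_univ]
    have h2 := Finset.card_le_card_of_injOn (s := Finset.univ.sigma P)
      (t := (Finset.univ : Finset (Fin k)) ×ˢ hE.finite.toFinset)
      (fun q => (q.1.1, q.2)) (fun q hq => by
        simp only [Finset.coe_sigma, Set.mem_sigma_iff, Finset.mem_coe] at hq
        simpa using hPE _ _ hq.2) hinj
    rw [h1, Finset.card_product, Finset.card_univ, Fintype.card_fin,
      ← Set.ncard_eq_toFinset_card _ hE.finite] at h2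
    exact (Nat.mul_le_mul_right _ Finset.card_image_le).trans (by rwa [Finset.card_univ])

/-! ### From identifiers back to networks -/

namespace Network

variable (G : Network)

theorem mem_nbrs_edges {v : G.V} {y : ℕ} :
    y ∈ nbrs G.edges (G.ident v) ↔ ∃ w, G.graph.Adj v w ∧ G.ident w = y := by
  constructor
  · rintro ⟨u, w, huw, he⟩
    obtain ⟨h, rfl⟩ := Prod.mk.inj he
    obtain rfl := G.ident_injective h
    exact ⟨w, huw, rfl⟩
  · rintro ⟨w, hw, rfl⟩
    exact ⟨v, w, hw, rfl⟩

theorem mem_edges {u v : G.V} : (G.ident u, G.ident v) ∈ G.edges ↔ G.graph.Adj u v := by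
  refine (G.mem_nbrs_edges (v := u)).trans ⟨?_, fun h => ⟨v, h, rfl⟩⟩
  rintro ⟨w, hw, he⟩
  rwa [← G.ident_injective he]

theorem nbrs_edges (v : G.V) :
    nbrs G.edges (G.ident v) = G.ident '' {w | G.graph.Adj v w} := by
  ext y
  rw [mem_nbrs_edges]
  rfl

theorem ncard_nbrs_edges (v : G.V) : (nbrs G.edges (G.ident v)).ncard = G.graph.degree v := by
  rw [nbrs_edges, Set.ncard_image_of_injective _ G.ident_injective,
    ← SimpleGraph.card_neighborSet_eq_degree, ← Nat.card_eq_fintype_card, ← Nat.card_coe_set_eq]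
  rfl

theorem nbrs_edges_of_notMem {x : ℕ} (hx : x ∉ Set.range G.ident) : nbrs G.edges x = ∅ := by
  ext y
  simp only [Set.mem_empty_iff_false, iff_false]
  rintro ⟨u, w, -, he⟩
  exact hx ⟨u, (Prod.mk.inj he).1.symm⟩

theorem nbrs_edges_cases {p : ℕ → Prop} (h0 : p 0) (h : ∀ v, p (G.graph.degree v)) (x : ℕ) :
    p (nbrs G.edges x).ncard := by
  by_cases hx : x ∈ Set.range G.ident
  · obtain ⟨v, rfl⟩ := hx
    rw [ncard_nbrs_edges]
    exact h v
  · rw [nbrs_edges_of_notMem G hx, Set.ncard_empty]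
    exact h0

theorem edges_ncard_le {Δ : ℕ} (h : ∀ v, G.graph.degree v ≤ Δ) :
    G.edges.ncard ≤ Fintype.card G.V * Δ := by
  classical
  have hsub : G.edges ⊆ (Finset.univ.biUnion fun v : G.V =>
      (G.graph.neighborFinset v).image fun w => (G.ident v, G.ident w) : Finset (ℕ × ℕ)) := by
    rintro _ ⟨u, v, huv, rfl⟩
    simp only [Finset.coe_biUnion, Set.mem_iUnion, Finset.coe_image, Set.mem_image, Finset.mem_coe]
    exact ⟨u, Finset.mem_univ _, v, (G.graph.mem_neighborFinset u v).2 huv, rfl⟩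
  refine (Set.ncard_le_ncard hsub (Finset.finite_toSet _)).trans ?_
  rw [Set.ncard_coe_finset]
  refine Finset.card_biUnion_le.trans ((Finset.sum_le_card_nsmul _ _ Δ fun v _ => ?_).trans ?_)
  · exact Finset.card_image_le.trans (h v)
  · rw [smul_eq_mul, Finset.card_univ]

theorem exists_isBipartiteEdges (hG : G.graph.IsBipartite) :
    ∃ side, IsBipartiteEdges G.edges side := by
  classical
  obtain ⟨c⟩ := hG
  refine ⟨fun x => decide (∃ v, G.ident v = x ∧ c v = 0), ?_, ?_, ?_⟩
  · refine (Set.finite_range fun p : G.V × G.V => (G.ident p.1, G.ident p.2)).subset ?_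
    rintro _ ⟨u, v, -, rfl⟩
    exact ⟨(u, v), rfl⟩
  · rintro _ ⟨u, v, h, rfl⟩
    exact ⟨v, u, h.symm, rfl⟩
  · rintro _ ⟨u, v, h, rfl⟩
    have key : ∀ w, (∃ v, G.ident v = G.ident w ∧ c v = 0) ↔ c w = 0 := fun w =>
      ⟨fun ⟨v, hv, h⟩ => G.ident_injective hv ▸ h, fun h => ⟨w, rfl, h⟩⟩
    have hne := c.valid h
    simp only [key]
    generalize c u = a at hne ⊢
    generalize c v = b at hne ⊢
    revert a b
    decide

theorem mem_hopBall_of_edist_le {u v : G.V} {j : ℕ} (h : G.graph.edist v u ≤ j) :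
    G.ident u ∈ hopBall G.edges j (G.ident v) := by
  obtain ⟨p, hp⟩ := SimpleGraph.exists_walk_of_edist_ne_top
    (ne_top_of_le_ne_top (ENat.natCast_ne_top j) h)
  have hlen : p.length ≤ j := by rw [← hp] at h; exact_mod_cast h
  refine hopBall_mono hlen ?_
  clear hlen hp h
  induction p with
  | nil => exact mem_hopBall_self _ _
  | cons h p ih => exact mem_hopBall_succ_of_nbrs (G.mem_edges.2 h) ih

theorem image_labelClass (v : G.V) (lab : ℕ → ℕ → ℕ) (l : ℕ) :
    labelClass G.edges lab (G.ident v) l =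
      G.ident '' {w | G.graph.Adj v w ∧ lab (G.ident v) (G.ident w) = l} := by
  ext y
  constructor
  · rintro ⟨h1, h2⟩
    obtain ⟨w, hw, rfl⟩ := G.mem_nbrs_edges.1 h1
    exact ⟨w, ⟨hw, h2⟩, rfl⟩
  · rintro ⟨w, ⟨hw, h2⟩, rfl⟩
    exact ⟨G.mem_nbrs_edges.2 ⟨w, hw, rfl⟩, h2⟩

/-- The outputs of the nodes follow the given labels. -/
def OutputsLabel {C : Type} (o : ℕ → C) (lab : ℕ → ℕ → ℕ) (out : G.V → ℕ → C) : Prop :=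
  ∀ u v, G.graph.Adj u v → out u (G.ident v) = o (lab (G.ident u) (G.ident v))

variable {G}

theorem splitting_of_outputsLabel (hG : G.graph.IsBipartite) (hdeg : ∀ v, Even (G.graph.degree v))
    (L : ℕ) {out : G.V → ℕ → Bool}
    (h : G.OutputsLabel (fun l => decide (l = 1)) (splitLabel G.edges L 1) out) :
    splitting G out := by
  obtain ⟨side, hE⟩ := G.exists_isBipartiteEdges hG
  have hk : ∀ x, 2 ^ 1 ∣ (nbrs G.edges x).ncard :=
    G.nbrs_edges_cases (p := fun n => 2 ^ 1 ∣ n) (dvd_zero _) fun v => (hdeg v).two_dvd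
  obtain ⟨h1, h2⟩ := ncard_labelClass hE L hk 1 le_rfl
  have hsymm : ∀ u v, G.graph.Adj u v → splitLabel G.edges L 1 (G.ident v) (G.ident u) =
      splitLabel G.edges L 1 (G.ident u) (G.ident v) := fun u v huv => (h1 _ (G.mem_edges.2 huv)).1
  have hlt : ∀ u v, G.graph.Adj u v → splitLabel G.edges L 1 (G.ident u) (G.ident v) < 2 :=
    fun u v huv => (h1 _ (G.mem_edges.2 huv)).2
  refine ⟨SimpleGraph.EdgeLabeling.mk
    (fun u v _ => decide (splitLabel G.edges L 1 (G.ident u) (G.ident v) = 1))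
    (fun u v huv => by rw [hsymm u v huv]), fun u v huv => h u v huv, fun v => ?_⟩
  simp only [SimpleGraph.EdgeLabeling.get_mk]
  have e1 := h2 (G.ident v) 1 (by norm_num)
  have e0 := h2 (G.ident v) 0 (by norm_num)
  rw [image_labelClass, Set.ncard_image_of_injective _ G.ident_injective] at e0 e1
  have s1 : {w | ∃ _ : G.graph.Adj v w,
      decide (splitLabel G.edges L 1 (G.ident v) (G.ident w) = 1) = true} =
      {w | G.graph.Adj v w ∧ splitLabel G.edges L 1 (G.ident v) (G.ident w) = 1} := by
    ext w; simp
  have s0 : {w | ∃ _ : G.graph.Adj v w,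
      decide (splitLabel G.edges L 1 (G.ident v) (G.ident w) = 1) = false} =
      {w | G.graph.Adj v w ∧ splitLabel G.edges L 1 (G.ident v) (G.ident w) = 0} := by
    ext w
    simp only [exists_prop, decide_eq_false_iff_not, Set.mem_ofPred_eq]
    refine and_congr_right fun hw => ?_
    have := hlt v w hw
    omega
  rw [s1, s0]
  omega

theorem edgeColoring_of_outputsLabel {k : ℕ} (hG : G.graph.IsBipartite)
    (hdeg : ∀ v, G.graph.degree v = 2 ^ k) (L : ℕ) {out : G.V → ℕ → Fin (2 ^ k)}
    (h : G.OutputsLabel (Fin.ofNat (2 ^ k)) (splitLabel G.edges L k) out) :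
    edgeColoring (2 ^ k) G out := by
  obtain ⟨side, hE⟩ := G.exists_isBipartiteEdges hG
  have hk : ∀ x, 2 ^ k ∣ (nbrs G.edges x).ncard :=
    G.nbrs_edges_cases (p := fun n => 2 ^ k ∣ n) (dvd_zero _) fun v => (hdeg v).symm.dvd
  obtain ⟨h1, h2⟩ := ncard_labelClass hE L hk k le_rfl
  have hsymm : ∀ u v, G.graph.Adj u v → splitLabel G.edges L k (G.ident v) (G.ident u) =
      splitLabel G.edges L k (G.ident u) (G.ident v) := fun u v huv => (h1 _ (G.mem_edges.2 huv)).1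
  have hlt : ∀ u v, G.graph.Adj u v → splitLabel G.edges L k (G.ident u) (G.ident v) < 2 ^ k :=
    fun u v huv => (h1 _ (G.mem_edges.2 huv)).2
  refine ⟨SimpleGraph.EdgeLabeling.mk
    (fun u v _ => Fin.ofNat (2 ^ k) (splitLabel G.edges L k (G.ident u) (G.ident v)))
    (fun u v huv => by rw [hsymm u v huv]), fun u v huv => h u v huv,
    fun v w₁ w₂ hw₁ hw₂ hne he => hne ?_⟩
  simp only [SimpleGraph.EdgeLabeling.get_mk] at he
  have he' := congrArg Fin.val he
  simp only [Fin.val_ofNat, Nat.mod_eq_of_lt (hlt v w₁ hw₁), Nat.mod_eq_of_lt (hlt v w₂ hw₂)] at he'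
  have e := h2 (G.ident v) _ (hlt v w₁ hw₁)
  rw [ncard_nbrs_edges, hdeg] at e
  have e1 : (labelClass G.edges (splitLabel G.edges L k) (G.ident v)
      (splitLabel G.edges L k (G.ident v) (G.ident w₁))).ncard = 1 :=
    Nat.eq_of_mul_eq_mul_left (Nat.two_pow_pos k) (by rw [e, mul_one])
  obtain ⟨a, ha⟩ := Set.ncard_eq_one.1 e1
  have m1 : G.ident w₁ ∈ ({a} : Set ℕ) := ha ▸ ⟨G.mem_edges.2 hw₁, rfl⟩
  have m2 : G.ident w₂ ∈ ({a} : Set ℕ) := ha ▸ ⟨G.mem_edges.2 hw₂, he'.symm⟩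
  exact G.ident_injective (m1.trans m2.symm)

end Network

/-- With advice that shows the marked edges, some LOCAL algorithm computes the labels. -/
theorem exists_algorithm_outputsLabel {C : Type} (o : ℕ → C) {𝒢 : Set Network} {k ρ l r T : ℕ}
    (hT : r + k * (6 * l + 1) + 1 ≤ T) (f : AdviceMap)
    (mark : LocalInfo → ℕ → ℕ × ℕ → Prop)
    (hloc : ∀ S S' : LocalInfo, ∀ i < k, ∀ d ∈ S.edges, S.Agree S' r d.1 →
      (mark S i d ↔ mark S' i d))
    (h𝒢 : ∀ G ∈ 𝒢, G.graph.IsBipartite ∧ ∀ v, 2 ^ k ∣ G.graph.degree v)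
    (hf : ∀ G ∈ 𝒢, ∃ C, IsMarking G.edges k ρ l C ∧ (∀ c ∈ C, mark (G.info (f G)) c.1 c.2) ∧
      ∀ i < k, ∀ d ∈ G.edges, mark (G.info (f G)) i d →
        ∃ c ∈ C, c.1 = i ∧ (d = c.2 ∨ d = c.2.swap)) :
    ∃ 𝒜 : LocalAlgorithm (ℕ → C), ∀ G ∈ 𝒢,
      G.OutputsLabel o (splitLabel G.edges (6 * l + 1) k) (𝒜.run G (f G) T) := by
  refine ⟨fullInformation fun K x y => o (decodeLabel mark (6 * l + 1) K k x y),
    fun G hG u v huv => ?_⟩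
  obtain ⟨hbip, hdeg⟩ := h𝒢 G hG
  obtain ⟨C, hC, hm1, hm2⟩ := hf G hG
  obtain ⟨side, hE⟩ := G.exists_isBipartiteEdges hbip
  have hk : ∀ x, 2 ^ k ∣ (nbrs G.edges x).ncard :=
    G.nbrs_edges_cases (p := fun n => 2 ^ k ∣ n) (dvd_zero _) hdeg
  obtain ⟨t, rfl⟩ : ∃ t, T = t + 1 := ⟨T - 1, by omega⟩
  obtain ⟨K, hK, hrun⟩ := fullInformation_run
    (fun K x y => o (decodeLabel mark (6 * l + 1) K k x y)) G (f G) t u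
  rw [hrun]
  have := decodeLabel_eq (S := G.info (f G)) (k := k) (L := 6 * l + 1) (r := r) (mark := mark)
    hE hk (fun S' i hi d hd hA => hloc _ _ i hi d hd hA) (fun i hi d hd hm => by
      obtain ⟨c, hc, rfl, hdc⟩ := hm2 i hi d hd hm
      have h := hC.color c hc
      rcases hdc with rfl | rfl
      · exact h
      · exact ((isTrailColoring_trailColor hE _ hk hi).swap _ (hC.mem c hc)).trans h)
    (fun i hi d hd hlong => by
      obtain ⟨m, hm, hmc⟩ := hC.hit i hi d hd hlong
      exact ⟨m, hm, hm1 _ hmc⟩) le_rfl (hK.mono (by omega)) (G.mem_edges.2 huv)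
  exact congrArg o this

namespace IsMarking

variable {E : Set (ℕ × ℕ)} {side : ℕ → Bool} {k ρ l : ℕ} {C : Finset (ℕ × ℕ × ℕ)}

/-- The triangle inequality, in the form in which nearby nodes are shown to belong to the same mark.
-/
theorem eq_of_mem_hopBall (hC : IsMarking E k ρ l C) (hE : IsBipartiteEdges E side)
    {c c' : ℕ × ℕ × ℕ} (hc : c ∈ C) (hc' : c' ∈ C) {a j b x y : ℕ} (hx : x ∈ hopBall E a c.2.1)
    (hxy : y ∈ hopBall E j x) (hy : y ∈ hopBall E b c'.2.1) (h : a + j + b ≤ ρ) : c = c' :=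
  hC.far c hc c' hc' <| hopBall_mono h <|
    hopBall_trans (hopBall_trans hx hxy) (hopBall_symm hE.swap_mem hy)

theorem mem_hopBall_one (hC : IsMarking E k ρ l C) {c : ℕ × ℕ × ℕ} (hc : c ∈ C) {x : ℕ}
    (hx : x = c.2.1 ∨ x = c.2.2) : x ∈ hopBall E 1 c.2.1 := by
  rcases hx with rfl | rfl
  · exact mem_hopBall_self _ _
  · exact nbrs_subset_hopBall_one (hC.mem c hc)

end IsMarking

theorem LocalInfo.adv_info (G : Network) (f : G.V → List Bool) (v : G.V) :
    (G.info f).adv (G.ident v) = {f v} := by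
  ext w
  constructor
  · rintro ⟨u, he⟩
    obtain ⟨h, rfl⟩ := Prod.mk.inj he
    rw [G.ident_injective h]
    rfl
  · rintro rfl
    exact ⟨v, rfl⟩

/-! ### Advice strings at the endpoints of the marks -/

section StringAdvice

variable (G : Network) (C : Finset (ℕ × ℕ × ℕ)) (w₀ : List Bool)

open Classical in
/-- The endpoints of the marked edges get the level in unary. -/
noncomputable def stringAdvice (v : G.V) : List Bool :=
  if h : ∃ c ∈ C, G.ident v = c.2.1 ∨ G.ident v = c.2.2 then List.replicate (h.choose.1 + 1) true
  else w₀

/-- Both endpoints have the unary code of the level as advice. -/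
def stringMark (S : LocalInfo) (i : ℕ) (d : ℕ × ℕ) : Prop :=
  List.replicate (i + 1) true ∈ S.adv d.1 ∧ List.replicate (i + 1) true ∈ S.adv d.2

theorem stringMark_congr {S S' : LocalInfo} {i : ℕ} {d : ℕ × ℕ} (hd : d ∈ S.edges)
    (h : S.Agree S' 1 d.1) : stringMark S i d ↔ stringMark S' i d := by
  rw [stringMark, stringMark, h.sameAt.2, (h.2 d.2 hd).sameAt.2]

variable {G C w₀} {side : ℕ → Bool} {k ρ l : ℕ}

theorem stringAdvice_eq_or (v : G.V) : stringAdvice G C w₀ v = w₀ ∨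
    ∃ c ∈ C, (G.ident v = c.2.1 ∨ G.ident v = c.2.2) ∧
      stringAdvice G C w₀ v = List.replicate (c.1 + 1) true := by
  by_cases h : ∃ c ∈ C, G.ident v = c.2.1 ∨ G.ident v = c.2.2
  · exact Or.inr ⟨h.choose, h.choose_spec.1, h.choose_spec.2, by rw [stringAdvice, dif_pos h]⟩
  · exact Or.inl (by rw [stringAdvice, dif_neg h])

theorem stringAdvice_eq (hC : IsMarking G.edges k ρ l C) (hE : IsBipartiteEdges G.edges side)
    (hρ : 2 ≤ ρ) {c : ℕ × ℕ × ℕ} (hc : c ∈ C) {v : G.V}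
    (hv : G.ident v = c.2.1 ∨ G.ident v = c.2.2) :
    stringAdvice G C w₀ v = List.replicate (c.1 + 1) true := by
  have h : ∃ c ∈ C, G.ident v = c.2.1 ∨ G.ident v = c.2.2 := ⟨c, hc, hv⟩
  rw [stringAdvice, dif_pos h]
  rw [hC.eq_of_mem_hopBall hE h.choose_spec.1 hc (hC.mem_hopBall_one h.choose_spec.1
    h.choose_spec.2) (mem_hopBall_self 0 _) (hC.mem_hopBall_one hc hv) hρ]

theorem stringMark_of_mem (hC : IsMarking G.edges k ρ l C) (hE : IsBipartiteEdges G.edges side)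
    (hρ : 2 ≤ ρ) {c : ℕ × ℕ × ℕ} (hc : c ∈ C) :
    stringMark (G.info (stringAdvice G C w₀)) c.1 c.2 := by
  obtain ⟨u, v, huv, he⟩ := hC.mem c hc
  rw [stringMark, he, LocalInfo.adv_info, LocalInfo.adv_info,
    stringAdvice_eq hC hE hρ hc (Or.inl (by rw [he])),
    stringAdvice_eq hC hE hρ hc (Or.inr (by rw [he]))]
  exact ⟨rfl, rfl⟩

/-- The default string is not a code, so both ends of `d` are endpoints of marks. Being adjacent,
they come from marks at distance at most `1 + 1 + 1`, hence from the same one, and are its two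
endpoints. -/
theorem exists_of_stringMark (hC : IsMarking G.edges k ρ l C)
    (hE : IsBipartiteEdges G.edges side) (hρ : 3 ≤ ρ) (hw₀ : ∀ n, w₀ ≠ List.replicate (n + 1) true)
    {i : ℕ} {d : ℕ × ℕ} (hd : d ∈ G.edges)
    (hm : stringMark (G.info (stringAdvice G C w₀)) i d) :
    ∃ c ∈ C, c.1 = i ∧ (d = c.2 ∨ d = c.2.swap) := by
  have key : ∀ v : G.V, List.replicate (i + 1) true ∈
      (G.info (stringAdvice G C w₀)).adv (G.ident v) →
      ∃ c ∈ C, (G.ident v = c.2.1 ∨ G.ident v = c.2.2) ∧ c.1 = i := by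
    intro v hv
    rw [LocalInfo.adv_info, Set.mem_singleton_iff] at hv
    rcases stringAdvice_eq_or (C := C) (w₀ := w₀) v with h | ⟨c, hc, h1, h2⟩
    · exact absurd (h.symm.trans hv.symm) (hw₀ i)
    · refine ⟨c, hc, h1, ?_⟩
      have := congrArg List.length (hv.trans h2)
      simp only [List.length_replicate] at this
      omega
  obtain ⟨u, v, huv, rfl⟩ := hd
  obtain ⟨c, hc, h1, rfl⟩ := key u hm.1
  obtain ⟨c', hc', h2, -⟩ := key v hm.2
  obtain rfl := hC.eq_of_mem_hopBall hE hc hc' (hC.mem_hopBall_one hc h1)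
    (nbrs_subset_hopBall_one (G.mem_edges.2 huv)) (hC.mem_hopBall_one hc' h2) hρ
  refine ⟨c, hc, rfl, ?_⟩
  have hne : G.ident u ≠ G.ident v := G.ident_injective.ne huv.ne
  rcases h1 with h1 | h1 <;> rcases h2 with h2 | h2
  · exact absurd (h1.trans h2.symm) hne
  · exact Or.inl (Prod.ext h1 h2)
  · exact Or.inr (Prod.ext h1 h2)
  · exact absurd (h1.trans h2.symm) hne

theorem ncard_ident_preimage_le (G : Network) (s : Finset ℕ) :
    {v | G.ident v ∈ s}.ncard ≤ s.card := by
  rw [← Set.ncard_coe_finset]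
  exact Set.ncard_le_ncard_of_injOn G.ident (fun v hv => hv) G.ident_injective.injOn
    (Finset.finite_toSet _)

/-- Two nodes with a code in the same ball lie on marks at distance at most `1 + 2 * α + 1`; hence
the ball meets only one mark. -/
theorem ncard_stringAdvice_ball_le (hC : IsMarking G.edges k ρ l C)
    (hE : IsBipartiteEdges G.edges side) {α : ℕ} (hρ : 2 * α + 2 ≤ ρ) (v : G.V) :
    {u | G.graph.edist v u ≤ α ∧ stringAdvice G C w₀ u ≠ w₀}.ncard ≤ 2 := by
  classical
  have key : ∀ u, G.graph.edist v u ≤ α → stringAdvice G C w₀ u ≠ w₀ →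
      ∃ c ∈ C, (G.ident u = c.2.1 ∨ G.ident u = c.2.2) ∧
        G.ident u ∈ hopBall G.edges α (G.ident v) := by
    intro u h1 h2
    obtain ⟨c, hc, h3, -⟩ := (stringAdvice_eq_or (C := C) (w₀ := w₀) u).resolve_left h2
    exact ⟨c, hc, h3, Network.mem_hopBall_of_edist_le G h1⟩
  rcases Set.eq_empty_or_nonempty {u | G.graph.edist v u ≤ α ∧ stringAdvice G C w₀ u ≠ w₀} with
    h | ⟨u, h1, h2⟩
  · rw [h]; simp
  · obtain ⟨c, hc, h3, h4⟩ := key u h1 h2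
    refine (Set.ncard_le_ncard ?_ (Set.toFinite _)).trans
      ((ncard_ident_preimage_le G {c.2.1, c.2.2}).trans Finset.card_le_two)
    rintro u' ⟨h1', h2'⟩
    obtain ⟨c', hc', h3', h4'⟩ := key u' h1' h2'
    obtain rfl := hC.eq_of_mem_hopBall hE hc hc' (hC.mem_hopBall_one hc h3)
      (hopBall_trans (hopBall_symm hE.swap_mem h4) h4') (hC.mem_hopBall_one hc' h3') (by omega)
    simpa using h3'

theorem ncard_stringAdvice_le :
    {v | stringAdvice G C w₀ v ≠ w₀}.ncard ≤ 2 * C.card := by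
  classical
  refine (Set.ncard_le_ncard (t := {v | G.ident v ∈ C.biUnion fun c => {c.2.1, c.2.2}}) ?_
    (Set.toFinite _)).trans ((ncard_ident_preimage_le G _).trans ?_)
  · intro v hv
    obtain ⟨c, hc, h, -⟩ := (stringAdvice_eq_or v).resolve_left hv
    simp only [Set.mem_ofPred_eq, Finset.mem_biUnion, Finset.mem_insert, Finset.mem_singleton]
    exact ⟨c, hc, h⟩
  · refine Finset.card_biUnion_le.trans ((Finset.sum_le_card_nsmul _ _ 2 fun c _ =>
      Finset.card_le_two).trans ?_)
    rw [smul_eq_mul, mul_comm]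

end StringAdvice

/-! ### Composable schemas -/

/-- Bipartite networks of maximum degree at most `Δ` in which `2 ^ k` divides all degrees. -/
def dvdBipartite (Δ k : ℕ) : Set Network :=
  {G | G.graph.IsBipartite ∧ ∀ v, 2 ^ k ∣ G.graph.degree v ∧ G.graph.degree v ≤ Δ}

theorem exists_marking_of_mem {Δ k ρ l : ℕ} {G : Network} (hG : G ∈ dvdBipartite Δ k) (hl0 : 0 < l)
    (hl : 4 * (k * ((Δ + 1) ^ ρ * Δ)) ≤ l) :
    (∃ side, IsBipartiteEdges G.edges side) ∧ (∀ x, (nbrs G.edges x).ncard ≤ Δ) ∧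
      (∀ x, 2 ^ k ∣ (nbrs G.edges x).ncard) ∧ ∃ C, IsMarking G.edges k ρ l C := by
  have hE := G.exists_isBipartiteEdges hG.1
  have hΔ := G.nbrs_edges_cases (p := fun n => n ≤ Δ) (Nat.zero_le _) fun v => (hG.2 v).2
  have hk := G.nbrs_edges_cases (p := fun n => 2 ^ k ∣ n) (dvd_zero _) fun v => (hG.2 v).1
  exact ⟨hE, hΔ, hk, exists_marking hE.choose_spec hk hΔ hl0 hl⟩

theorem hasComposableSchema_of_outputsLabel {C : Type} (o : ℕ → C) {𝒢 : Set Network}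
    {P : GraphProblem (ℕ → C)} {Δ k : ℕ} (h𝒢 : 𝒢 ⊆ dvdBipartite Δ k)
    (hP : ∀ G ∈ 𝒢, ∀ L out, G.OutputsLabel o (splitLabel G.edges L k) out → P G out)
    (hΔ : 2 ≤ Δ) (hkΔ : k ≤ Δ) {A : ℝ → ℕ → ℝ}
    (hA : ∀ c : ℝ, 0 < c → ∀ γ : ℕ, 2 ≤ γ → ∀ α : ℕ, A c γ ≤ α →
      1 ≤ α ∧ (k : ℝ) ≤ c * α / (γ : ℝ) ^ 3) :
    HasComposableSchema 𝒢 P 2 A (fun α => Δ ^ (20 * α)) := by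
  classical
  intro c hc γ hγ α hα
  obtain ⟨hα1, hβ⟩ := hA c hc γ hγ α hα
  refine ⟨k, hβ, ?_⟩
  set ρ := 2 * α + 3 with hρ
  set X := (Δ + 1) ^ ρ * Δ with hX
  set l := 4 * (k * X) + 1 with hl
  have hmark : ∀ G ∈ 𝒢, ∃ C, IsMarking G.edges k ρ l C := fun G hG =>
    (exists_marking_of_mem (h𝒢 hG) (by omega) (Nat.le_succ _)).2.2.2
  have hside : ∀ G ∈ 𝒢, ∃ side, IsBipartiteEdges G.edges side := fun G hG =>
    G.exists_isBipartiteEdges (h𝒢 hG).1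
  choose! C hC using hmark
  choose! side hE using hside
  refine ⟨fun G => stringAdvice G (C G) [], ⟨fun G hG v => ?_, ?_⟩, fun G hG v => ?_⟩
  · change (stringAdvice G (C G) [] v).length ≤ k
    rcases stringAdvice_eq_or (C := C G) (w₀ := []) v with h | ⟨c, hc, -, h⟩
    · rw [h]; simp
    · rw [h, List.length_replicate]
      exact (hC G hG).level_lt c hc
  -- The exponent is `4 * α + 7` from `X`, plus `2` from two factors `k ≤ Δ`, plus `6` for the
  -- constants; `1 ≤ α` bounds the sum by `20 * α`.
  · have hT : 1 + k * (6 * l + 1) + 1 ≤ Δ ^ (20 * α) := by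
      have hX1 : X ≤ Δ ^ (4 * α + 7) := by
        have h1 : Δ + 1 ≤ Δ ^ 2 := by nlinarith
        calc X ≤ (Δ ^ 2) ^ ρ * Δ := by rw [hX]; gcongr
          _ = Δ ^ (4 * α + 7) := by rw [← pow_mul, ← pow_succ]; congr 1; omega
      have hX2 : 1 ≤ X := Nat.mul_pos (by positivity) (by omega)
      have h64 : 64 ≤ Δ ^ 6 := by
        calc 64 = 2 ^ 6 := by norm_num
          _ ≤ Δ ^ 6 := by gcongr
      have hk2 : k ≤ Δ * X := hkΔ.trans (Nat.le_mul_of_pos_right _ hX2)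
      calc 1 + k * (6 * l + 1) + 1 = 24 * (k * (k * X)) + 7 * k + 2 := by rw [hl]; ring
        _ ≤ 24 * (Δ * (Δ * X)) + 7 * (Δ * (Δ * X)) + 2 * (Δ * (Δ * X)) := by
            gcongr
            · calc k ≤ Δ * X := hk2
                _ ≤ Δ * (Δ * X) := by gcongr; exact Nat.le_mul_of_pos_left _ (by omega)
            · have : 1 ≤ Δ * (Δ * X) := Nat.mul_pos (by omega) (Nat.mul_pos (by omega) hX2)
              omega
        _ ≤ 64 * (Δ * (Δ * X)) := by omega
        _ ≤ Δ ^ 6 * (Δ * (Δ * Δ ^ (4 * α + 7))) := by gcongr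
        _ = Δ ^ (4 * α + 15) := by ring
        _ ≤ Δ ^ (20 * α) := Nat.pow_le_pow_right (by omega) (by omega)
    obtain ⟨𝒜, h𝒜⟩ := exists_algorithm_outputsLabel o (𝒢 := 𝒢) (k := k) (ρ := ρ) (l := l) (r := 1)
      (T := Δ ^ (20 * α)) hT (fun G => stringAdvice G (C G) []) stringMark
      (fun S S' i _ d hd h => stringMark_congr hd h)
      (fun G hG => ⟨(h𝒢 hG).1, fun v => ((h𝒢 hG).2 v).1⟩)
      (fun G hG => ⟨C G, hC G hG,
        fun c hc => stringMark_of_mem (hC G hG) (hE G hG) (by omega) hc,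
        fun i _ d hd hm => exists_of_stringMark (hC G hG) (hE G hG) (by omega)
          (fun n => by simp [List.replicate_succ]) hd hm⟩)
    exact ⟨𝒜, fun G hG => hP G hG _ _ (h𝒜 G hG)⟩
  · exact ncard_stringAdvice_ball_le (hC G hG) (hE G hG) (by omega) v

/-! ### Sparse one-bit advice for splitting -/

theorem isSparseAdvice_of_le {𝒢 : Set Network} {f : AdviceMap} {ε : ℝ} (hε : 0 < ε)
    (hf : ∀ G ∈ 𝒢, ∀ v, f G v = [true] ∨ f G v = [false]) {l b : ℕ} (hl : 0 < l)
    (hb : (b : ℝ) ≤ ε * l)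
    (h : ∀ G ∈ 𝒢, {v | f G v = [true]}.ncard * l ≤ b * Fintype.card G.V) :
    IsSparseAdvice 𝒢 ε f := by
  intro G hG
  have hsum : {v | f G v = [false]}.ncard + {v | f G v = [true]}.ncard = Fintype.card G.V := by
    rw [← Set.ncard_union_eq _ (Set.toFinite _) (Set.toFinite _), ← Nat.card_eq_fintype_card,
      ← Set.ncard_univ]
    · congr 1
      ext v
      simpa using (hf G hG v).symm
    · rw [Set.disjoint_left]
      intro v h1 h2
      have := h1.symm.trans h2
      simp at this
  have hsum' : ({v | f G v = [false]}.ncard : ℝ) + {v | f G v = [true]}.ncard =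
      Fintype.card G.V := by exact_mod_cast hsum
  rw [hsum']
  refine div_le_of_le_mul₀ (Nat.cast_nonneg _) hε.le ?_
  have h1 : ({v | f G v = [true]}.ncard : ℝ) * l ≤ b * Fintype.card G.V := by
    exact_mod_cast h G hG
  have hl' : (0 : ℝ) < l := by exact_mod_cast hl
  have h2 : (b : ℝ) * Fintype.card G.V ≤ ε * l * Fintype.card G.V := by gcongr
  refine le_of_mul_le_mul_right ?_ hl'
  nlinarith

/-- Splitting has only the level `0`, whose unary code is the single bit `1`. So the string advice
with `[false]` in place of the empty string is already uniform. -/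
theorem hasSparseOneBitSchema_splitting {Δ m : ℕ} {ε : ℝ} (hε : 0 < ε) (hm : 2 ≤ ε * m)
    (hΔ : 2 ≤ Δ) : HasSparseOneBitSchema (evenBipartite Δ) splitting ε (Δ ^ (m + 20)) := by
  classical
  have h𝒢 : evenBipartite Δ ⊆ dvdBipartite Δ 1 := fun G hG =>
    ⟨hG.1, fun v => ⟨by simpa using (hG.2.2 v).two_dvd, (G.graph.degree_le_maxDegree v).trans hG.2.1⟩⟩
  have hm0 : 0 < m := by
    rcases Nat.eq_zero_or_pos m with rfl | h
    · simp at hm; linarith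
    · exact h
  set X := (Δ + 1) ^ 3 * Δ with hX
  have hX1 : 1 ≤ X := Nat.mul_pos (by positivity) (by omega)
  -- The factor `m` gives sparsity: the number of ones is at most `2 * Δ * n / l`, and `2 * Δ ≤ ε *
  -- l` because `2 ≤ ε * m` and `Δ ≤ X`.
  set l := 4 * (1 * X) * m with hl
  have hXΔ : Δ ≤ X := Nat.le_mul_of_pos_left _ (by positivity)
  have hl0 : 0 < l := by positivity
  have hmark : ∀ G ∈ evenBipartite Δ, ∃ C, IsMarking G.edges 1 3 l C := fun G hG =>
    (exists_marking_of_mem (h𝒢 hG) hl0 (Nat.le_mul_of_pos_right _ hm0)).2.2.2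
  have hside : ∀ G ∈ evenBipartite Δ, ∃ side, IsBipartiteEdges G.edges side := fun G hG =>
    G.exists_isBipartiteEdges (h𝒢 hG).1
  choose! C hC using hmark
  choose! side hE using hside
  have hval : ∀ G ∈ evenBipartite Δ, ∀ v, stringAdvice G (C G) [false] v = [true] ∨
      stringAdvice G (C G) [false] v = [false] := by
    intro G hG v
    rcases stringAdvice_eq_or (C := C G) (w₀ := [false]) v with h | ⟨c, hc, -, h⟩
    · exact Or.inr h
    · left
      have := (hC G hG).level_lt c hc
      rw [h, show c.1 = 0 by omega]; rfl
  have hlen : ∀ G ∈ evenBipartite Δ, ∀ v, (stringAdvice G (C G) [false] v).length = 1 := by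
    intro G hG v
    rcases hval G hG v with h | h <;> rw [h] <;> rfl
  refine ⟨fun G => stringAdvice G (C G) [false], ⟨fun G hG v => (hlen G hG v).le, ?_⟩, hlen,
    isSparseAdvice_of_le hε hval (b := 2 * Δ) hl0 ?_ ?_⟩
  · have hT : 1 + 1 * (6 * l + 1) + 1 ≤ Δ ^ (m + 20) := by
      have hX2 : X ≤ Δ ^ 7 := by
        have h1 : Δ + 1 ≤ Δ ^ 2 := by nlinarith
        calc X ≤ (Δ ^ 2) ^ 3 * Δ := by rw [hX]; gcongr
          _ = Δ ^ 7 := by ring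
      have h64 : 27 ≤ Δ ^ 6 := by
        calc 27 ≤ 2 ^ 6 := by norm_num
          _ ≤ Δ ^ 6 := by gcongr
      have hmΔ : m ≤ Δ ^ m := (Nat.lt_pow_self (by omega)).le
      have h1 : 1 ≤ X * m := Nat.mul_pos hX1 hm0
      calc 1 + 1 * (6 * l + 1) + 1 = 24 * (X * m) + 3 := by rw [hl]; ring
        _ ≤ 27 * (X * m) := by omega
        _ ≤ Δ ^ 6 * (Δ ^ 7 * Δ ^ m) := by gcongr
        _ = Δ ^ (m + 13) := by ring
        _ ≤ Δ ^ (m + 20) := Nat.pow_le_pow_right (by omega) (by omega)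
    obtain ⟨𝒜, h𝒜⟩ := exists_algorithm_outputsLabel (fun l => decide (l = 1))
      (𝒢 := evenBipartite Δ) (k := 1) (ρ := 3) (l := l) (r := 1)
      (T := Δ ^ (m + 20)) hT (fun G => stringAdvice G (C G) [false]) stringMark
      (fun S S' i _ d hd h => stringMark_congr hd h)
      (fun G hG => ⟨(h𝒢 hG).1, fun v => ((h𝒢 hG).2 v).1⟩)
      (fun G hG => ⟨C G, hC G hG,
        fun c hc => stringMark_of_mem (hC G hG) (hE G hG) (by omega) hc,
        fun i _ d hd hm => exists_of_stringMark (hC G hG) (hE G hG) (by omega)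
          (fun n => by simp [List.replicate_succ]) hd hm⟩)
    exact ⟨𝒜, fun G hG => Network.splitting_of_outputsLabel hG.1 hG.2.2 _ (h𝒜 G hG)⟩
  · have : (Δ : ℝ) ≤ X := by exact_mod_cast hXΔ
    rw [hl]
    push_cast
    nlinarith [mul_le_mul hm this (by positivity) (by positivity)]
  · intro G hG
    have h1 := (hC G hG).card_mul_le
    have h2 := G.edges_ncard_le (Δ := Δ) fun v => ((h𝒢 hG).2 v).2
    have h3 : {v | stringAdvice G (C G) [false] v = [true]}.ncard ≤ 2 * (C G).card := by
      refine (Set.ncard_le_ncard ?_ (Set.toFinite _)).trans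
        (ncard_stringAdvice_le (G := G) (w₀ := [false]))
      intro v hv h
      have := (h : _ = _).symm.trans hv
      simp at this
    nlinarith

/-! ### Sparse one-bit advice for edge coloring: beacons -/

/-- Each marked edge comes with a node whose distance from the edge encodes the level. -/
def IsBeacon (E : Set (ℕ × ℕ)) (C : Finset (ℕ × ℕ × ℕ)) (z : ℕ × ℕ × ℕ → ℕ) : Prop :=
  ∀ c ∈ C, z c ∈ hopBall E (3 * c.1 + 3) c.2.1 ∧ z c ∉ hopBall E (3 * c.1 + 2) c.2.1

/-- If no node had this distance, a trail starting at the mark would never leave the ball of radius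
`3 * c.1 + 2`. But the trail is long and has `l + 1` distinct edges, more than start in that ball.
-/
theorem IsMarking.exists_isBeacon {E : Set (ℕ × ℕ)} {side : ℕ → Bool} {Δ k ρ l : ℕ}
    {C : Finset (ℕ × ℕ × ℕ)} (hC : IsMarking E k ρ l C) (hE : IsBipartiteEdges E side)
    (hk : ∀ x, 2 ^ k ∣ (nbrs E x).ncard) (hΔ : ∀ x, (nbrs E x).ncard ≤ Δ)
    (hρ : 3 * k ≤ ρ) (hl : (Δ + 1) ^ ρ * Δ ≤ l) : ∃ z, IsBeacon E C z := by
  suffices h : ∀ c ∈ C, ∃ z, z ∈ hopBall E (3 * c.1 + 3) c.2.1 ∧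
      z ∉ hopBall E (3 * c.1 + 2) c.2.1 by
    choose! z hz using h
    exact ⟨z, hz⟩
  intro c hc
  by_contra hno
  push Not at hno
  have hck := hC.level_lt c hc
  have hev := even_ncard_labelClass hE (6 * l + 1) hk hck
  set st := trailStep E (splitLabel E (6 * l + 1) c.1) with hst
  have hmem := trailStep_iterate_mem hE hev (hC.mem c hc)
  have hball : ∀ j, (st^[j] c.2).1 ∈ hopBall E (3 * c.1 + 2) c.2.1 := by
    intro j
    induction j with
    | zero => exact mem_hopBall_self _ _
    | succ j ih =>
      rw [Function.iterate_succ_apply']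
      have h1 : (st^[j] c.2).2 ∈ hopBall E (3 * c.1 + 2 + 1) c.2.1 :=
        hopBall_trans ih (nbrs_subset_hopBall_one (hmem j))
      exact hno _ h1
  obtain ⟨B, hB, hBmem⟩ := hE.exists_edges_from_hopBall hΔ ρ c.2.1
  have hcard := Finset.card_le_card_of_injOn (s := Finset.range (l + 1)) (t := B)
    (fun j => st^[j] c.2) (fun j _ => hBmem _ (hmem j) (hopBall_mono (by omega) (hball j))) ?_
  · rw [Finset.card_range] at hcard
    omega
  · have key : ∀ i j, i ≤ j → j ≤ l → st^[i] c.2 = st^[j] c.2 → i = j := by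
      intro i j hij hj he
      obtain ⟨a, rfl⟩ := Nat.exists_eq_add_of_le hij
      by_contra hne
      apply hC.long c hc a (by omega) (by omega)
      have h1 : (trailSystem hE hev).τ^[i] ((trailSystem hE hev).τ^[a] ⟨c.2, hC.mem c hc⟩) =
          (trailSystem hE hev).τ^[i] ⟨c.2, hC.mem c hc⟩ := by
        apply Subtype.ext
        rw [← Function.iterate_add_apply, trailSystem_iterate, trailSystem_iterate]
        exact he.symm
      have h2 := congrArg Subtype.val ((trailSystem hE hev).τ_injective.iterate i h1)
      rwa [trailSystem_iterate] at h2
    intro i hi j hj he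
    simp only [Finset.coe_range, Set.mem_Iio] at hi hj
    rcases le_total i j with hij | hij
    · exact key i j hij (by omega) he
    · exact (key j i hij (by omega) he.symm).symm

section BeaconAdvice

variable (G : Network) (C : Finset (ℕ × ℕ × ℕ)) (z : ℕ × ℕ × ℕ → ℕ)

open Classical in
/-- The endpoints of the marked edges and their beacons get the bit `1`. -/
noncomputable def beaconAdvice (v : G.V) : List Bool :=
  if G.ident v ∈ C.biUnion fun c => {c.2.1, c.2.2, z c} then [true] else [false]

/-- Two adjacent nodes with the bit `1`, and a beacon at the distance that encodes the level. -/
def beaconMark (S : LocalInfo) (i : ℕ) (d : ℕ × ℕ) : Prop :=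
  [true] ∈ S.adv d.1 ∧ [true] ∈ S.adv d.2 ∧ ∃ z, [true] ∈ S.adv z ∧
    z ∈ hopBall S.edges (3 * i + 3) d.1 ∧ z ∉ hopBall S.edges (3 * i + 2) d.1

theorem beaconMark_congr {S S' : LocalInfo} {i k : ℕ} (hi : i < k) {d : ℕ × ℕ}
    (hd : d ∈ S.edges) (h : S.Agree S' (3 * k) d.1) : beaconMark S i d ↔ beaconMark S' i d := by
  have h1 : S.SameAt S' d.2 :=
    ((show S.Agree S' 1 d.1 from h.mono (by omega)).2 d.2 hd)
  have h3 : S.Agree S' (3 * i + 3) d.1 := h.mono (by omega)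
  have h2 : S.Agree S' (3 * i + 2) d.1 := h.mono (by omega)
  rw [beaconMark, beaconMark, h.sameAt.2, h1.2, ← h3.hopBall_eq, ← h2.hopBall_eq]
  refine and_congr_right fun _ => and_congr_right fun _ => exists_congr fun z => ?_
  rw [← and_assoc, ← and_assoc]
  refine and_congr_left fun _ => and_congr_left fun hz => ?_
  rw [(h3.sameAt_of_mem_hopBall hz).2]

variable {G C z} {side : ℕ → Bool} {k ρ l : ℕ}

theorem beaconAdvice_eq_true {v : G.V} : beaconAdvice G C z v = [true] ↔
    ∃ c ∈ C, G.ident v = c.2.1 ∨ G.ident v = c.2.2 ∨ G.ident v = z c := by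
  classical
  unfold beaconAdvice
  split_ifs with h
  · simpa using h
  · simpa using h

theorem mem_adv_beaconAdvice {x : ℕ} (h : [true] ∈ (G.info (beaconAdvice G C z)).adv x) :
    ∃ c ∈ C, x = c.2.1 ∨ x = c.2.2 ∨ x = z c := by
  obtain ⟨v, he⟩ := h
  obtain ⟨rfl, h⟩ := Prod.mk.inj he
  exact beaconAdvice_eq_true.1 h.symm

theorem Network.exists_ident_of_mem_hopBall (G : Network) {j y : ℕ} {v : G.V}
    (h : y ∈ hopBall G.edges j (G.ident v)) : ∃ w, G.ident w = y := by
  induction j generalizing v with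
  | zero => exact ⟨v, h.symm⟩
  | succ j ih =>
    rcases h with rfl | h
    · exact ⟨v, rfl⟩
    · simp only [Set.mem_iUnion] at h
      obtain ⟨x, hx, h⟩ := h
      obtain ⟨w, -, rfl⟩ := G.mem_nbrs_edges.1 hx
      exact ih h

theorem beaconMark_of_mem (hC : IsMarking G.edges k ρ l C) (hz : IsBeacon G.edges C z)
    {c : ℕ × ℕ × ℕ} (hc : c ∈ C) : beaconMark (G.info (beaconAdvice G C z)) c.1 c.2 := by
  obtain ⟨u, v, huv, he⟩ := hC.mem c hc
  obtain ⟨h1, h2⟩ := hz c hc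
  obtain ⟨w, hw⟩ := G.exists_ident_of_mem_hopBall (v := u) (y := z c) (j := 3 * c.1 + 3)
    (by rw [he] at h1; exact h1)
  refine ⟨?_, ?_, z c, ?_, h1, h2⟩
  · rw [he, LocalInfo.adv_info]
    exact (beaconAdvice_eq_true.2 ⟨c, hc, Or.inl (by rw [he])⟩).symm
  · rw [he, LocalInfo.adv_info]
    exact (beaconAdvice_eq_true.2 ⟨c, hc, Or.inr (Or.inl (by rw [he]))⟩).symm
  · rw [← hw, LocalInfo.adv_info]
    exact (beaconAdvice_eq_true.2 ⟨c, hc, Or.inr (Or.inr hw)⟩).symm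

/-- All ones that are involved lie within `3 * k` of their marks and within `3 * k` of the first
node of `d`, so the separation `9 * k + 1` forces a single mark. Beacons are not adjacent to its
endpoints, so `d` is the marked edge up to direction, and the remaining one is the beacon. -/
theorem exists_of_beaconMark (hC : IsMarking G.edges k ρ l C)
    (hE : IsBipartiteEdges G.edges side) (hz : IsBeacon G.edges C z) (hρ : 9 * k + 1 ≤ ρ)
    {i : ℕ} (hi : i < k) {d : ℕ × ℕ} (hd : d ∈ G.edges)
    (hm : beaconMark (G.info (beaconAdvice G C z)) i d) :
    ∃ c ∈ C, c.1 = i ∧ (d = c.2 ∨ d = c.2.swap) := by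
  obtain ⟨x, y⟩ := d
  obtain ⟨hx, hy, w, hw, hw1, hw2⟩ := hm
  simp only at hx hy hw1 hw2
  obtain ⟨c, hc, hx⟩ := mem_adv_beaconAdvice hx
  obtain ⟨c', hc', hy⟩ := mem_adv_beaconAdvice hy
  obtain ⟨c'', hc'', hw⟩ := mem_adv_beaconAdvice hw
  have hnear : ∀ {c x}, c ∈ C → (x = c.2.1 ∨ x = c.2.2 ∨ x = z c) →
      x ∈ hopBall G.edges (3 * k) c.2.1 := by
    intro c x hc hx
    have := hC.level_lt c hc
    rcases hx with h | h | h
    · exact hopBall_mono (by omega) (hC.mem_hopBall_one hc (Or.inl h))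
    · exact hopBall_mono (by omega) (hC.mem_hopBall_one hc (Or.inr h))
    · rw [h]
      exact hopBall_mono (by omega) (hz c hc).1
  obtain rfl := hC.eq_of_mem_hopBall hE hc hc' (hnear hc hx) (nbrs_subset_hopBall_one hd)
    (hnear hc' hy) (by omega)
  obtain rfl := hC.eq_of_mem_hopBall hE hc hc'' (hnear hc hx) hw1 (hnear hc'' hw) (by omega)
  have hne : x ≠ y := hE.fst_ne_snd hd
  have hyx : x ∈ nbrs G.edges y := hE.swap_mem _ hd
  -- Even for level `0` the distance is `3`, not less: a neighbor of an endpoint is at distance at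
  -- most `2` from `c.2.1`.
  have hfarz : ∀ t, (t = c.2.1 ∨ t = c.2.2) → ¬ z c ∈ nbrs G.edges t := fun t ht h =>
    (hz c hc).2 (hopBall_mono (by omega)
      (hopBall_trans (hC.mem_hopBall_one hc ht) (nbrs_subset_hopBall_one h)))
  have hx' : x = c.2.1 ∨ x = c.2.2 := by
    rcases hx with h | h | h
    · exact Or.inl h
    · exact Or.inr h
    · exfalso
      rw [h] at hyx hne
      rcases hy with h' | h' | h'
      · exact hfarz y (Or.inl h') hyx
      · exact hfarz y (Or.inr h') hyx
      · exact hne h'.symm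
  have hy' : y = c.2.1 ∨ y = c.2.2 := by
    rcases hy with h | h | h
    · exact Or.inl h
    · exact Or.inr h
    · exact absurd (h ▸ hd) (hfarz x hx')
  have hdc : (x, y) = c.2 ∨ (x, y) = c.2.swap := by
    rcases hx' with h1 | h1 <;> rcases hy' with h2 | h2
    · exact absurd (h1.trans h2.symm) hne
    · exact Or.inl (Prod.ext h1 h2)
    · exact Or.inr (Prod.ext h1 h2)
    · exact absurd (h1.trans h2.symm) hne
  refine ⟨c, hc, ?_, hdc⟩
  have hxa : x ∈ hopBall G.edges 1 c.2.1 := hC.mem_hopBall_one hc hx'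
  have hax : c.2.1 ∈ hopBall G.edges 1 x := hopBall_symm hE.swap_mem hxa
  have hclose : ∀ t, t ∈ hopBall G.edges 1 x → w ≠ t := fun t ht h =>
    hw2 (h ▸ hopBall_mono (by omega) ht)
  have hwz : w = z c := by
    rcases hdc with h | h <;> obtain ⟨h1, h2⟩ := Prod.ext_iff.1 h <;>
      simp only [Prod.fst_swap, Prod.snd_swap] at h1 h2
    · rcases hw with h | h | h
      · exact absurd (h.trans h1.symm) (hclose x (mem_hopBall_self _ _))
      · exact absurd (h.trans h2.symm) (hclose y (nbrs_subset_hopBall_one hd))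
      · exact h
    · rcases hw with h | h | h
      · exact absurd (h.trans h2.symm) (hclose y (nbrs_subset_hopBall_one hd))
      · exact absurd (h.trans h1.symm) (hclose x (mem_hopBall_self _ _))
      · exact h
  subst hwz
  obtain ⟨hz1, hz2⟩ := hz c hc
  -- It is unknown which endpoint comes first, so the distance is known up to `1`; the spacing `3`
  -- between levels tolerates this.
  have h1 : ¬ 1 + (3 * i + 3) ≤ 3 * c.1 + 2 := fun h =>
    hz2 (hopBall_mono h (hopBall_trans hxa hw1))
  have h2 : ¬ 1 + (3 * c.1 + 3) ≤ 3 * i + 2 := fun h =>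
    hw2 (hopBall_mono h (hopBall_trans hax hz1))
  omega

theorem ncard_beaconAdvice_le : {v | beaconAdvice G C z v = [true]}.ncard ≤ 3 * C.card := by
  classical
  refine (Set.ncard_le_ncard (t := {v | G.ident v ∈ C.biUnion fun c => {c.2.1, c.2.2, z c}}) ?_
    (Set.toFinite _)).trans ((ncard_ident_preimage_le G _).trans ?_)
  · intro v hv
    obtain ⟨c, hc, h⟩ := beaconAdvice_eq_true.1 hv
    simp only [Set.mem_ofPred_eq, Finset.mem_biUnion, Finset.mem_insert, Finset.mem_singleton]
    exact ⟨c, hc, h⟩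
  · refine Finset.card_biUnion_le.trans ((Finset.sum_le_card_nsmul _ _ 3 fun c _ =>
      Finset.card_le_three).trans ?_)
    rw [smul_eq_mul, mul_comm]

end BeaconAdvice

theorem regularBipartite_subset (k : ℕ) :
    regularBipartite (2 ^ k) ⊆ dvdBipartite (2 ^ k) k := fun _ hG =>
  ⟨hG.1, fun v => ⟨(hG.2 v).symm.dvd, (hG.2 v).le⟩⟩

/-- The number of rounds for edge coloring with one bit per node. -/
def edgeColoringRounds (m Δ : ℕ) : ℕ :=
  3 * Δ + Δ * (6 * ((4 * (Δ * ((Δ + 1) ^ (9 * Δ + 1) * Δ)) + (Δ + 1) ^ (9 * Δ + 1) * Δ) * m) + 1) + 1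

theorem computable_edgeColoringRounds (m : ℕ) : Computable (edgeColoringRounds m) := by
  have hpow : Primrec₂ ((· ^ ·) : ℕ → ℕ → ℕ) := Primrec₂.unpaired'.1 Nat.Primrec.pow
  have add : ∀ {f g : ℕ → ℕ}, Primrec f → Primrec g → Primrec fun n => f n + g n :=
    fun hf hg => Primrec.nat_add.comp hf hg
  have mul : ∀ {f g : ℕ → ℕ}, Primrec f → Primrec g → Primrec fun n => f n * g n :=
    fun hf hg => Primrec.nat_mul.comp hf hg
  have const : ∀ a : ℕ, Primrec fun _ : ℕ => a := fun a => Primrec.const a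
  have hid : Primrec fun n : ℕ => n := Primrec.id
  have hX : Primrec fun n : ℕ => (n + 1) ^ (9 * n + 1) * n :=
    mul (hpow.comp (add hid (const 1)) (add (mul (const 9) hid) (const 1))) hid
  exact (add (add (mul (const 3) hid) (mul hid (add (mul (const 6)
    (mul (add (mul (const 4) (mul hid hX)) hX) (const m))) (const 1)))) (const 1)).to_comp

/-- The true round bound involves `k = log Δ`; in `edgeColoringRounds` it is replaced by the larger
`Δ`, which keeps the function evidently computable. -/
theorem hasSparseOneBitSchema_edgeColoring {k m : ℕ} {ε : ℝ} (hε : 0 < ε) (hm : 2 ≤ ε * m) :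
    HasSparseOneBitSchema (regularBipartite (2 ^ k)) (edgeColoring (2 ^ k)) ε
      (edgeColoringRounds m (2 ^ k)) := by
  classical
  have h𝒢 := regularBipartite_subset k
  have hm0 : 0 < m := by
    rcases Nat.eq_zero_or_pos m with rfl | h
    · simp at hm; linarith
    · exact h
  have hkΔ : k ≤ 2 ^ k := Nat.lt_two_pow_self.le
  have hΔ0 : 0 < 2 ^ k := by positivity
  set 𝒢 := regularBipartite (2 ^ k) with h𝒢def
  set ρ := 9 * k + 1 with hρ
  set X := (2 ^ k + 1) ^ ρ * 2 ^ k with hX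
  have hX1 : 1 ≤ X := Nat.mul_pos (by positivity) hΔ0
  have hXΔ : 2 ^ k ≤ X := Nat.le_mul_of_pos_left _ (by positivity)
  -- The first summand serves the selection of the marks and the second the beacons, besides keeping
  -- `l` positive for `k = 0`; `m` serves sparsity.
  set l := (4 * (k * X) + X) * m with hl
  have hl0 : 0 < l := by positivity
  have hXl : X ≤ l := (Nat.le_add_left _ _).trans (Nat.le_mul_of_pos_right _ hm0)
  have hlX : 4 * (k * X) ≤ l := (Nat.le_add_right _ _).trans (Nat.le_mul_of_pos_right _ hm0)
  have hmark : ∀ G ∈ 𝒢, ∃ side C z, IsBipartiteEdges G.edges side ∧ IsMarking G.edges k ρ l C ∧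
      IsBeacon G.edges C z := by
    intro G hG
    obtain ⟨⟨side, hE⟩, hΔ, hk, C, hC⟩ := exists_marking_of_mem (h𝒢 hG) hl0 hlX
    obtain ⟨z, hz⟩ := hC.exists_isBeacon hE hk hΔ (by omega) hXl
    exact ⟨side, C, z, hE, hC, hz⟩
  choose! side C z hE hC hz using hmark
  have hval : ∀ G ∈ 𝒢, ∀ v, beaconAdvice G (C G) (z G) v = [true] ∨
      beaconAdvice G (C G) (z G) v = [false] := by
    intro G hG v
    unfold beaconAdvice
    split_ifs <;> simp
  have hlen : ∀ G ∈ 𝒢, ∀ v, (beaconAdvice G (C G) (z G) v).length = 1 := by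
    intro G hG v
    rcases hval G hG v with h | h <;> rw [h] <;> rfl
  refine ⟨fun G => beaconAdvice G (C G) (z G), ⟨fun G hG v => (hlen G hG v).le, ?_⟩, hlen,
    isSparseAdvice_of_le hε hval (b := 3 * k * 2 ^ k) hl0 ?_ ?_⟩
  · have hT : 3 * k + k * (6 * l + 1) + 1 ≤ edgeColoringRounds m (2 ^ k) := by
      have hX' : X ≤ (2 ^ k + 1) ^ (9 * 2 ^ k + 1) * 2 ^ k := by
        rw [hX, hρ]
        gcongr
        omega
      rw [hl, edgeColoringRounds]
      gcongr
    obtain ⟨𝒜, h𝒜⟩ := exists_algorithm_outputsLabel (Fin.ofNat (2 ^ k))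
      (𝒢 := 𝒢) (k := k) (ρ := ρ) (l := l) (r := 3 * k)
      (T := edgeColoringRounds m (2 ^ k)) hT (fun G => beaconAdvice G (C G) (z G)) beaconMark
      (fun S S' i hi d hd h => beaconMark_congr hi hd h)
      (fun G hG => ⟨(h𝒢 hG).1, fun v => ((h𝒢 hG).2 v).1⟩)
      (fun G hG => ⟨C G, hC G hG, fun c hc => beaconMark_of_mem (hC G hG) (hz G hG) hc,
        fun i hi d hd hm =>
          exists_of_beaconMark (hC G hG) (hE G hG) (hz G hG) le_rfl hi hd hm⟩)
    exact ⟨𝒜, fun G hG => Network.edgeColoring_of_outputsLabel hG.1 hG.2 _ (h𝒜 G hG)⟩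
  · have h1 : (2 : ℝ) ^ k ≤ X := by exact_mod_cast hXΔ
    have h2 : (4 * (k * X) : ℝ) * m ≤ l := by
      rw [hl]
      push_cast
      nlinarith [Nat.cast_nonneg (α := ℝ) X, Nat.cast_nonneg (α := ℝ) m]
    have h3 : (0 : ℝ) ≤ 4 * (k * X) := by positivity
    push_cast
    calc (3 * k * 2 ^ k : ℝ) ≤ 3 * k * X := by gcongr
      _ ≤ 4 * (k * X) * 2 := by nlinarith
      _ ≤ 4 * (k * X) * (ε * m) := by gcongr
      _ = ε * (4 * (k * X) * m) := by ring
      _ ≤ ε * l := by gcongr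
  · intro G hG
    have h1 := (hC G hG).card_mul_le
    have h2 := G.edges_ncard_le (Δ := 2 ^ k) fun v => ((h𝒢 hG).2 v).2
    have h3 := ncard_beaconAdvice_le (G := G) (C := C G) (z := z G)
    calc _ ≤ 3 * (C G).card * l := Nat.mul_le_mul_right _ h3
      _ = 3 * ((C G).card * l) := by ring
      _ ≤ 3 * (k * (Fintype.card G.V * 2 ^ k)) :=
          Nat.mul_le_mul_left _ (h1.trans (Nat.mul_le_mul_left _ h2))
      _ = 3 * k * 2 ^ k * Fintype.card G.V := by ring

/-! ### Trivial degrees and conclusion -/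

/-- Even degrees below `2` vanish, so there are no edges. The case is separate because powers of `Δ`
bound the running time only for `2 ≤ Δ`. -/
theorem splitting_of_degree_le_one {Δ : ℕ} (hΔ : Δ < 2) {G : Network} (hG : G ∈ evenBipartite Δ)
    (out : G.V → ℕ → Bool) : splitting G out := by
  have hadj : ∀ u v, ¬ G.graph.Adj u v := by
    intro u v huv
    have h1 := (G.graph.degree_le_maxDegree u).trans hG.2.1
    have h2 : 0 < G.graph.degree u := (G.graph.degree_pos_iff_exists_adj u).2 ⟨v, huv⟩
    obtain ⟨a, ha⟩ := hG.2.2 u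
    omega
  refine ⟨fun _ => true, fun u v h => absurd h (hadj u v), fun v => ?_⟩
  simp [hadj]

theorem edgeColoring_one {G : Network} (hG : G ∈ regularBipartite 1) (out : G.V → ℕ → Fin 1) :
    edgeColoring 1 G out := by
  refine ⟨fun _ => 0, fun u v h => Subsingleton.elim _ _, fun v w₁ w₂ h₁ h₂ hne => ?_⟩
  exfalso
  have h := hG.2 v
  rw [← SimpleGraph.card_neighborFinset_eq_degree, Finset.card_eq_one] at h
  obtain ⟨a, ha⟩ := h
  have m₁ := (G.graph.mem_neighborFinset v w₁).2 h₁
  have m₂ := (G.graph.mem_neighborFinset v w₂).2 h₂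
  rw [ha, Finset.mem_singleton] at m₁ m₂
  exact hne (m₁.trans m₂.symm)

/-- An algorithm without communication. -/
def constantAlgorithm {Out : Type} (o : Out) : LocalAlgorithm Out where
  State := Unit
  Msg := Unit
  init _ _ _ _ _ := ()
  send _ _ := ()
  recv _ _ := ()
  output _ := o

theorem hasComposableSchema_of_forall {Out : Type} [Inhabited Out] {𝒢 : Set Network}
    {P : GraphProblem Out} (h : ∀ G ∈ 𝒢, ∀ out, P G out) (γ₀ : ℕ) {A : ℝ → ℕ → ℝ} {T : ℕ → ℕ} :
    HasComposableSchema 𝒢 P γ₀ A T := by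
  intro c hc γ _ α _
  refine ⟨0, by push_cast; positivity, fun _ _ => [], ⟨fun _ _ _ => le_rfl,
    constantAlgorithm default, fun G hG => h G hG _⟩, fun G _ v => ?_⟩
  simp

theorem hasSparseOneBitSchema_of_forall {Out : Type} [Inhabited Out] {𝒢 : Set Network}
    {P : GraphProblem Out} (h : ∀ G ∈ 𝒢, ∀ out, P G out) {ε : ℝ} (hε : 0 < ε) {T : ℕ} :
    HasSparseOneBitSchema 𝒢 P ε T := by
  refine ⟨fun _ _ => [false], ⟨fun _ _ _ => le_rfl, constantAlgorithm default,
    fun G hG => h G hG _⟩, fun _ _ _ => rfl, fun G _ => ?_⟩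
  simpa using hε.le

/-- One bit is enough for the single level, and `γ ^ 3 / c ≤ α` says precisely that `1 ≤ c * α / γ ^
3`. -/
theorem hasComposableSchema_splitting (Δ : ℕ) :
    HasComposableSchema (evenBipartite Δ) splitting 2 (fun c γ => (γ : ℝ) ^ 3 / c)
      (fun α => Δ ^ (20 * α)) := by
  rcases lt_or_ge Δ 2 with hΔ | hΔ
  · exact hasComposableSchema_of_forall (fun G hG => splitting_of_degree_le_one hΔ hG) 2
  refine hasComposableSchema_of_outputsLabel (fun l => decide (l = 1)) (k := 1) (fun G hG =>
    ⟨hG.1, fun v => ⟨by simpa using (hG.2.2 v).two_dvd,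
      (G.graph.degree_le_maxDegree v).trans hG.2.1⟩⟩)
    (fun G hG L out h => Network.splitting_of_outputsLabel hG.1 hG.2.2 L h) hΔ (by omega) ?_
  intro c hc γ hγ α hα
  have hγ' : (0 : ℝ) < γ := by exact_mod_cast (by omega : 0 < γ)
  constructor
  · have : (0 : ℝ) < α := lt_of_lt_of_le (by positivity) hα
    exact_mod_cast this
  · rw [le_div_iff₀ (by positivity)]
    rw [div_le_iff₀ hc] at hα
    push_cast
    linarith

theorem hasComposableSchema_edgeColoring (k : ℕ) :
    HasComposableSchema (regularBipartite (2 ^ k)) (edgeColoring (2 ^ k)) 2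
      (fun c γ => (((2 ^ k : ℕ) : ℝ) * γ) ^ 3 * Real.logb 2 ((2 ^ k : ℕ) : ℝ) / c)
      (fun α => (2 ^ k) ^ (20 * α)) := by
  rcases Nat.eq_zero_or_pos k with rfl | hk
  · exact hasComposableSchema_of_forall (fun G hG => edgeColoring_one hG) 2
  refine hasComposableSchema_of_outputsLabel (Fin.ofNat (2 ^ k)) (k := k)
    (regularBipartite_subset k)
    (fun G hG L out h => Network.edgeColoring_of_outputsLabel hG.1 hG.2 L h)
    (by simpa using Nat.pow_le_pow_right (n := 2) (by norm_num) hk) Nat.lt_two_pow_self.le ?_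
  intro c hc γ hγ α hα
  have hγ' : (0 : ℝ) < γ := by exact_mod_cast (by omega : 0 < γ)
  have hk' : (0 : ℝ) < k := by exact_mod_cast hk
  have hlog : Real.logb 2 ((2 ^ k : ℕ) : ℝ) = k := by
    push_cast
    rw [Real.logb_pow, Real.logb_self_eq_one (by norm_num), mul_one]
  rw [hlog] at hα
  have h1 : (1 : ℝ) ≤ (2 ^ k : ℕ) := by exact_mod_cast Nat.one_le_two_pow
  constructor
  · have : (0 : ℝ) < α := lt_of_lt_of_le (by positivity) hα
    exact_mod_cast this
  · rw [le_div_iff₀ (by positivity)]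
    rw [div_le_iff₀ hc, mul_pow] at hα
    -- The factor `Δ ^ 3` in `A` is slack: `k * γ ^ 3 ≤ c * α` is all that strings of length `k`
    -- require.
    have h2 : (1 : ℝ) ≤ ((2 ^ k : ℕ) : ℝ) ^ 3 := one_le_pow₀ h1
    have h3 : (0 : ℝ) ≤ k * (γ : ℝ) ^ 3 := by positivity
    nlinarith

theorem mainTheorem10 :
    -- splitting: composable schema with `γ₀ = O(1)`, `A(c, γ) = Θ(γ³)`, `T(α, Δ) = Δ ^ O(α)`
    (∃ (γ₀ C : ℕ) (A : ℝ → ℕ → ℝ),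
      (∀ c : ℝ, 0 < c → ∃ k₁ k₂ : ℝ, 0 < k₁ ∧ ∀ γ : ℕ,
        k₁ * (γ : ℝ) ^ 3 ≤ A c γ ∧ A c γ ≤ k₂ * (γ : ℝ) ^ 3) ∧
      ∀ Δ : ℕ,
        HasComposableSchema (evenBipartite Δ) splitting γ₀ A (fun α => Δ ^ (C * α))) ∧
    -- splitting: sparse 1-bit schema with `Δ ^ O(1)` rounds
    (∀ ε : ℝ, 0 < ε → ∃ C : ℕ, ∀ Δ : ℕ,
      HasSparseOneBitSchema (evenBipartite Δ) splitting ε (Δ ^ C)) ∧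
    -- `Δ`-edge coloring, `Δ` a power of two: composable schema with `γ₀ = O(Δ)`,
    -- `A(c, γ) = Θ((Δ γ)³ log Δ)`, `T(α, Δ) = Δ ^ O(α)`
    (∃ (γ₀ : ℕ → ℕ) (K C : ℕ) (A : ℕ → ℝ → ℕ → ℝ),
      (∀ Δ : ℕ, (∃ k : ℕ, Δ = 2 ^ k) → γ₀ Δ ≤ K * Δ) ∧
      (∀ c : ℝ, 0 < c → ∃ k₁ k₂ : ℝ, 0 < k₁ ∧ ∀ Δ : ℕ, (∃ k : ℕ, Δ = 2 ^ k) → ∀ γ : ℕ,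
        k₁ * (((Δ : ℝ) * γ) ^ 3 * Real.logb 2 Δ) ≤ A Δ c γ ∧
        A Δ c γ ≤ k₂ * (((Δ : ℝ) * γ) ^ 3 * Real.logb 2 Δ)) ∧
      ∀ Δ : ℕ, (∃ k : ℕ, Δ = 2 ^ k) →
        HasComposableSchema (regularBipartite Δ) (edgeColoring Δ) (γ₀ Δ) (A Δ)
          (fun α => Δ ^ (C * α))) ∧
    -- `Δ`-edge coloring, `Δ` a power of two: sparse 1-bit schema with `f(Δ)` rounds,
    -- `f` computable
    (∀ ε : ℝ, 0 < ε → ∃ f : ℕ → ℕ, Computable f ∧ ∀ Δ : ℕ, (∃ k : ℕ, Δ = 2 ^ k) →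
      HasSparseOneBitSchema (regularBipartite Δ) (edgeColoring Δ) ε (f Δ)) := by
  have hm : ∀ ε : ℝ, 0 < ε → ∃ m : ℕ, 2 ≤ ε * m := by
    intro ε hε
    obtain ⟨m, hm⟩ := exists_nat_ge (2 / ε)
    exact ⟨m, by rwa [div_le_iff₀' hε] at hm⟩
  refine ⟨⟨2, 20, fun c γ => (γ : ℝ) ^ 3 / c, fun c hc => ⟨1 / c, 1 / c, by positivity, fun γ => ?_⟩,
      hasComposableSchema_splitting⟩,
    fun ε hε => ?_,
    ⟨fun _ => 2, 2, 20, fun Δ c γ => ((Δ : ℝ) * γ) ^ 3 * Real.logb 2 Δ / c, ?_,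
      fun c hc => ⟨1 / c, 1 / c, by positivity, fun Δ _ γ => ?_⟩, ?_⟩,
    fun ε hε => ?_⟩
  · constructor <;> exact le_of_eq (by ring)
  · obtain ⟨m, hm⟩ := hm ε hε
    refine ⟨m + 20, fun Δ => ?_⟩
    rcases lt_or_ge Δ 2 with hΔ | hΔ
    · exact hasSparseOneBitSchema_of_forall (fun G hG => splitting_of_degree_le_one hΔ hG) hε
    · exact hasSparseOneBitSchema_splitting hε hm hΔ
  · rintro Δ ⟨k, rfl⟩
    exact Nat.le_mul_of_pos_right _ (by positivity)
  · constructor <;> exact le_of_eq (by ring)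
  · rintro Δ ⟨k, rfl⟩
    exact hasComposableSchema_edgeColoring k
  · obtain ⟨m, hm⟩ := hm ε hε
    refine ⟨edgeColoringRounds m, computable_edgeColoringRounds m, ?_⟩
    rintro Δ ⟨k, rfl⟩
    exact hasSparseOneBitSchema_edgeColoring hε hm
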